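/- Let $n \ge 1$ and let $X$ be a compact connected smooth $n$-manifold (without boundary). Let $t_0 > 0$ and let $(L,h,K)$ be a smooth CMC Einstein flow on $X$ with time interval $(0,t_0]$, parametrized by the Hubble time. That is, $L(t) \ge 0$ are functions, $h(t)$ are Riemannian metrics and $K(t)$ are symmetric covariant $2$-tensor fields on $X$, depending smoothly on $(t,x) \in (0,t_0] \times X$, such that, with $R_{ij}$ and $R$ the Ricci and scalar curvature of $h(t)$, $H = h^{ij}K_{ij}$ and $K^0 = K - \frac{H}{n} h$, the constraint equations $$R - |K^0|^2 + \left(1 - \tfrac1n\right) H^2 = 0, \qquad \nabla_i K^i_{\ j} - \nabla_j H = 0$$ and the evolution equations $$\frac{\partial h_{ij}}{\partial t} = -2 L K_{ij}, \qquad \frac{\partial K_{ij}}{\partial t} = L H K_{ij} - 2 L h^{kl} K_{ik} K_{lj} - L_{;ij} + L R_{ij}$$ hold, and $H = -\frac{n}{t}$ at each time $t$ (so there is a crushing singularity as $t \to 0$). For $s > 0$ put $L_s(u) = L(su)$, $h_s(u) = s^{-2} h(su)$ and $K_s(u) = s^{-1} K(su)$, let $|K_s|^2$ be the squared norm of $K_s(u)$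 with respect to $h_s(u)$, and let $R_s$ be the scalar curvature of $h_s(u)$. Suppose that $R \le 0$ on $(0,t_0] \times X$. Then the limit $\operatorname{dvol}_0 = \lim_{t \to 0} t^{-1} \operatorname{dvol}_{h(t)}$ exists as a measure on $X$, in the sense that $\operatorname{dvol}_0(A) = \lim_{t \to 0} t^{-1} \operatorname{dvol}_{h(t)}(A)$ for every Borel set $A \subset X$. Moreover, for every $\Lambda > 1$, $$\lim_{s \to 0} \left| L_s - \frac1n \right| = \lim_{s \to 0} \left| |K_s|^2 - \frac{n^2}{u^2} \right| = \lim_{s \to 0} |R_s| = 0$$ in $L^1\left([\Lambda^{-1},\Lambda] \times X, \, du \operatorname{dvol}_0\right)$; in particular these three functions belong to this $L^1$ space for all sufficiently small $s > 0$. -/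

import Mathlib

open scoped Manifold ContDiff Topology ENNReal
open MeasureTheory

noncomputable section

namespace EinsteinFlow

/-! ### Coordinate formulas on an open subset of `ℝⁿ`

`g : ℝⁿ → Matrix` is the component matrix `g_{ij}(y)` of a metric in a coordinate system. -/

section Coordinates

variable {n : ℕ}

/-- The partial derivative `∂_i f`. -/
def pd (i : Fin n) (f : EuclideanSpace ℝ (Fin n) → ℝ) (y : EuclideanSpace ℝ (Fin n)) : ℝ :=
  fderiv ℝ f y (EuclideanSpace.single i 1)

/-- The Christoffel symbol `Γ^k_{ij} = ½ g^{kl} (∂_i g_{jl} + ∂_j g_{il} - ∂_l g_{ij})`. -/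
def christoffel (g : EuclideanSpace ℝ (Fin n) → Matrix (Fin n) (Fin n) ℝ) (k i j : Fin n)
    (y : EuclideanSpace ℝ (Fin n)) : ℝ :=
  (1 / 2) * ∑ l, (g y)⁻¹ k l *
    (pd i (fun z => g z j l) y + pd j (fun z => g z i l) y - pd l (fun z => g z i j) y)

/-- The Ricci tensor
`R_{ij} = ∂_k Γ^k_{ij} - ∂_j Γ^k_{ik} + Γ^k_{kl} Γ^l_{ij} - Γ^k_{jl} Γ^l_{ik}`. -/
def ricci (g : EuclideanSpace ℝ (Fin n) → Matrix (Fin n) (Fin n) ℝ)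
    (y : EuclideanSpace ℝ (Fin n)) : Matrix (Fin n) (Fin n) ℝ :=
  Matrix.of fun i j =>
    ∑ k, (pd k (christoffel g k i j) y - pd j (christoffel g k i k) y) +
    ∑ k, ∑ l, (christoffel g k k l y * christoffel g l i j y -
      christoffel g k j l y * christoffel g l i k y)

/-- The covariant Hessian `f_{;ij} = ∂_i ∂_j f - Γ^k_{ij} ∂_k f`. -/
def hessian (g : EuclideanSpace ℝ (Fin n) → Matrix (Fin n) (Fin n) ℝ)
    (f : EuclideanSpace ℝ (Fin n) → ℝ) (i j : Fin n) (y : EuclideanSpace ℝ (Fin n)) : ℝ :=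
  pd i (pd j f) y - ∑ k, christoffel g k i j y * pd k f y

/-- The covariant derivative `∇_k A_{ij} = ∂_k A_{ij} - Γ^l_{ki} A_{lj} - Γ^l_{kj} A_{il}`. -/
def covDeriv (g A : EuclideanSpace ℝ (Fin n) → Matrix (Fin n) (Fin n) ℝ) (k i j : Fin n)
    (y : EuclideanSpace ℝ (Fin n)) : ℝ :=
  pd k (fun z => A z i j) y - ∑ l, christoffel g l k i y * A y l j -
    ∑ l, christoffel g l k j y * A y i l

/-- The divergence `∇_i A^i_j = g^{ik} ∇_k A_{ij}`. -/
def divergence (g A : EuclideanSpace ℝ (Fin n) → Matrix (Fin n) (Fin n) ℝ) (j : Fin n)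
    (y : EuclideanSpace ℝ (Fin n)) : ℝ :=
  ∑ i, ∑ k, (g y)⁻¹ i k * covDeriv g A k i j y

/-- The trace `g^{ij} A_{ij}` of a covariant 2-tensor at a point. -/
def traceWith (g A : Matrix (Fin n) (Fin n) ℝ) : ℝ :=
  ∑ i, ∑ j, g⁻¹ i j * A i j

/-- The squared norm `|A|² = g^{ik} g^{jl} A_{ij} A_{kl}` of a covariant 2-tensor at a point. -/
def normSqWith (g A : Matrix (Fin n) (Fin n) ℝ) : ℝ :=
  ∑ i, ∑ j, ∑ k, ∑ l, g⁻¹ i k * g⁻¹ j l * A i j * A k l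

end Coordinates

/-! ### Tensors on a manifold -/

section Manifold

variable {n : ℕ} {X : Type*} [TopologicalSpace X] [ChartedSpace (EuclideanSpace ℝ (Fin n)) X]

variable (n X) in
/-- Covariant 2-tensor fields on `X` (no regularity assumed). -/
abbrev TwoTensor : Type _ :=
  ∀ x : X, TangentSpace (𝓡 n) x →L[ℝ] TangentSpace (𝓡 n) x →L[ℝ] ℝ

variable (n X) in
/-- Smooth Riemannian metrics on `X`. -/
abbrev Metric [IsManifold (𝓡 n) ∞ X] : Type _ :=
  Bundle.ContMDiffRiemannianMetric (𝓡 n) ∞ (EuclideanSpace ℝ (Fin n))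
    (fun x : X => TangentSpace (𝓡 n) x)

/-- The component matrix of a covariant 2-tensor field in the chart `φ`, as a function of the
coordinates: `A_{ij}(y) = A(∂_i, ∂_j)` at the point `φ⁻¹(y)`. -/
def comp (φ : OpenPartialHomeomorph X (EuclideanSpace ℝ (Fin n))) (A : TwoTensor n X)
    (y : EuclideanSpace ℝ (Fin n)) : Matrix (Fin n) (Fin n) ℝ :=
  Matrix.of fun i j => A (φ.symm y)
    (mfderiv (𝓡 n) (𝓡 n) φ.symm y (EuclideanSpace.single i (1 : ℝ)))
    (mfderiv (𝓡 n) (𝓡 n) φ.symm y (EuclideanSpace.single j (1 : ℝ)))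

/-- The trace of `A` with respect to the metric `g`, as a function on `X`. -/
def trace (g A : TwoTensor n X) (x : X) : ℝ :=
  traceWith (comp (chartAt (EuclideanSpace ℝ (Fin n)) x) g
      (chartAt (EuclideanSpace ℝ (Fin n)) x x))
    (comp (chartAt (EuclideanSpace ℝ (Fin n)) x) A (chartAt (EuclideanSpace ℝ (Fin n)) x x))

/-- `|A|²` with respect to the metric `g`, as a function on `X`. -/
def normSq (g A : TwoTensor n X) (x : X) : ℝ :=
  normSqWith (comp (chartAt (EuclideanSpace ℝ (Fin n)) x) g
      (chartAt (EuclideanSpace ℝ (Fin n)) x x))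
    (comp (chartAt (EuclideanSpace ℝ (Fin n)) x) A (chartAt (EuclideanSpace ℝ (Fin n)) x x))

/-- The scalar curvature of the metric `g`, as a function on `X`. -/
def scalarCurvature (g : TwoTensor n X) (x : X) : ℝ :=
  traceWith (comp (chartAt (EuclideanSpace ℝ (Fin n)) x) g
      (chartAt (EuclideanSpace ℝ (Fin n)) x x))
    (ricci (comp (chartAt (EuclideanSpace ℝ (Fin n)) x) g)
      (chartAt (EuclideanSpace ℝ (Fin n)) x x))

/-- The volume measure `√(det g_{ij}) dy` of the metric `g` on the domain of the chart `φ`, viewed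
as a measure on `X`. -/
def chartVol [MeasurableSpace X] (φ : OpenPartialHomeomorph X (EuclideanSpace ℝ (Fin n)))
    (g : TwoTensor n X) : Measure X :=
  (((volume : Measure (EuclideanSpace ℝ (Fin n))).restrict φ.target).withDensity
    (fun y => ENNReal.ofReal (Real.sqrt (comp φ g y).det))).map φ.symm

/-- The Riemannian volume measure `dvol_g`. The chart measures agree on overlaps, and the measure
obtained by gluing them is the least measure on `X` that dominates each of them. -/
def dvol [MeasurableSpace X] (g : TwoTensor n X) : Measure X :=
  ⨆ φ ∈ atlas (EuclideanSpace ℝ (Fin n)) X, chartVol φ g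

/-- A (smooth) Einstein flow on `X` with time interval `I`: lapse functions `L(t) ≥ 0`, Riemannian
metrics `h(t)` and symmetric covariant 2-tensor fields `K(t)`, all smooth in space and time, which
satisfy the constraint and evolution equations. The tensor equations are written in components,
in every chart of the atlas. Only the values at times in `I` matter. -/
structure IsEinsteinFlow [IsManifold (𝓡 n) ∞ X] (I : Set ℝ) (L : ℝ → X → ℝ)
    (h : ℝ → Metric n X) (K : ℝ → TwoTensor n X) : Prop where
  lapse_nonneg : ∀ t ∈ I, ∀ x, 0 ≤ L t x
  symm : ∀ t ∈ I, ∀ x v w, K t x v w = K t x w v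
  smooth_lapse : ∀ φ ∈ atlas (EuclideanSpace ℝ (Fin n)) X,
    ContDiffOn ℝ ∞ (fun p : ℝ × EuclideanSpace ℝ (Fin n) => L p.1 (φ.symm p.2)) (I ×ˢ φ.target)
  smooth_metric : ∀ φ ∈ atlas (EuclideanSpace ℝ (Fin n)) X, ∀ i j,
    ContDiffOn ℝ ∞ (fun p : ℝ × EuclideanSpace ℝ (Fin n) => comp φ (h p.1).inner p.2 i j)
      (I ×ˢ φ.target)
  smooth_secondFundamentalForm : ∀ φ ∈ atlas (EuclideanSpace ℝ (Fin n)) X, ∀ i j,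
    ContDiffOn ℝ ∞ (fun p : ℝ × EuclideanSpace ℝ (Fin n) => comp φ (K p.1) p.2 i j)
      (I ×ˢ φ.target)
  /-- `R - |K⁰|² + (1 - 1/n) H² = 0`, where `K⁰ = K - (H/n) h`. -/
  hamiltonian_constraint : ∀ φ ∈ atlas (EuclideanSpace ℝ (Fin n)) X, ∀ t ∈ I, ∀ y ∈ φ.target,
    let g := comp φ (h t).inner
    let k := comp φ (K t)
    let H := traceWith (g y) (k y)
    traceWith (g y) (ricci g y) - normSqWith (g y) (k y - (H / n) • g y) + (1 - 1 / n) * H ^ 2 = 0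
  /-- `∇_i K^i_j - ∇_j H = 0`. -/
  momentum_constraint : ∀ φ ∈ atlas (EuclideanSpace ℝ (Fin n)) X, ∀ t ∈ I, ∀ y ∈ φ.target, ∀ j,
    let g := comp φ (h t).inner
    let k := comp φ (K t)
    divergence g k j y - pd j (fun z => traceWith (g z) (k z)) y = 0
  /-- `∂h_{ij}/∂t = - 2 L K_{ij}`. -/
  evolution_metric : ∀ φ ∈ atlas (EuclideanSpace ℝ (Fin n)) X, ∀ t ∈ I, ∀ y ∈ φ.target, ∀ i j,
    HasDerivWithinAt (fun τ => comp φ (h τ).inner y i j)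
      (-2 * L t (φ.symm y) * comp φ (K t) y i j) I t
  /-- `∂K_{ij}/∂t = L H K_{ij} - 2 L h^{kl} K_{ik} K_{lj} - L_{;ij} + L R_{ij}`. -/
  evolution_secondFundamentalForm :
    ∀ φ ∈ atlas (EuclideanSpace ℝ (Fin n)) X, ∀ t ∈ I, ∀ y ∈ φ.target, ∀ i j,
    let g := comp φ (h t).inner
    let k := comp φ (K t)
    let H := traceWith (g y) (k y)
    let ℓ := fun z => L t (φ.symm z)
    HasDerivWithinAt (fun τ => comp φ (K τ) y i j)
      (ℓ y * H * k y i j - 2 * ℓ y * ∑ a, ∑ b, (g y)⁻¹ a b * k y i a * k y b j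
        - hessian g ℓ i j y + ℓ y * ricci g y i j) I t

/-- A CMC Einstein flow on `X` with time interval `I`, parametrized by the Hubble time
`t = - n / H`: the mean curvature `H = h^{ij} K_{ij}` of the time-`t` slice is the constant
`- n / t`. -/
structure IsHubbleCMCFlow [IsManifold (𝓡 n) ∞ X] (I : Set ℝ) (L : ℝ → X → ℝ)
    (h : ℝ → Metric n X) (K : ℝ → TwoTensor n X) : Prop extends IsEinsteinFlow I L h K where
  meanCurvature_eq : ∀ t ∈ I, ∀ x, trace (h t).inner (K t) x = - (n / t)

/-! ### Rescaling -/

/-- `L_s(u) = L(su)`. -/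
def rescaledLapse (L : ℝ → X → ℝ) (s u : ℝ) (x : X) : ℝ := L (s * u) x

/-- `h_s(u) = s⁻² h(su)`. -/
def rescaledMetric [IsManifold (𝓡 n) ∞ X] (h : ℝ → Metric n X) (s u : ℝ) : TwoTensor n X :=
  fun x => (s ^ 2)⁻¹ • (h (s * u)).inner x

/-- `K_s(u) = s⁻¹ K(su)`. -/
def rescaledK (K : ℝ → TwoTensor n X) (s u : ℝ) : TwoTensor n X :=
  fun x => s⁻¹ • K (s * u) x

end Manifold

/-- The functions `f_s` (for `s > 0` near `0`) lie in `L¹(μ)` and tend to `0` in `L¹(μ)` as `s → 0`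
from above. -/
def TendstoZeroInL1 {α : Type*} [MeasurableSpace α] (μ : Measure α) (f : ℝ → α → ℝ) : Prop :=
  (∀ᶠ s in 𝓝[>] (0 : ℝ), MemLp (f s) 1 μ) ∧
    Filter.Tendsto (fun s => eLpNorm (f s) 1 μ) (𝓝[>] (0 : ℝ)) (𝓝 0)

end EinsteinFlow

end

/-!
# Convergence of nonpositively curved CMC Einstein flows at a crushing singularity

Write `H = -n/t`. The Hamiltonian constraint becomes `R = |K|² - n²/t²`, and the trace of the
evolution equation of `K` becomes the lapse equation `-ΔL + L |K|² = n/t²`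
(`IsHubbleCMCFlow.lapse_equation`). The theorem follows from these two equations.

*Monotonicity.* If `R ≤ 0`, then `|K|² ≤ n²/t²`, and at a minimum of `L` the lapse equation gives
`L ≥ 1/n` (`IsHubbleCMCFlow.lapse_ge`). Since `∂_t dvol = (n/t) L dvol`, the normalized volume
density `κ = t⁻¹ dvol_{h(t)} / dvol_{h(t₀)}` satisfies `t ∂_t κ = (n L - 1) κ ≥ 0`. It therefore
decreases to a limit as `t → 0`, and `dvol₀` is the limit density times `dvol_{h(t₀)}`; convergence
on Borel sets is dominated convergence, with `κ` at time `t₀` as the majorant.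

*The lapse.* Since the limit density is at most `κ`, the `L¹` norm of `L_s - 1/n` is at most a
constant times the integral over `u ∈ [Λ⁻¹, Λ]` and `X` of `(n L(su) - 1) κ(su) / u = ∂_u (κ(su))`.
By Fubini and the fundamental theorem of calculus this is the integral of `κ(sΛ) - κ(s/Λ)`, which
tends to zero because both terms have the same limit (`IsMonotoneDensity.tendstoZeroInL1`).

*The curvature.* Integrating the lapse equation over the closed manifold `X`, and using `n L ≥ 1`
again, bounds the integral of `|R|` at time `t` by `n²/t²` times the integral of `n L - 1`
(`IsHubbleCMCFlow.lintegral_scalarCurvature_le`). After rescaling this is the quantity that was just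
shown to tend to zero. The functions `R_s` and `|K_s|² - n²/u²` are both equal to `s² R(su)`.

The geometric input is built in coordinates. The chart volumes agree on overlaps by the change of
variables formula, so that `dvol` restricts to the chart volume on the domain of each chart
(`restrict_dvol`). The divergence theorem (`integral_laplacian_eq_zero`) is proved with a partition
of unity `η_i`: in each chart an integration by parts gives `∫ η_i ΔL = -∫ ⟨dη_i, dL⟩`, and
`∑ dη_i = 0`. Only the first-order pairing, not the Laplacian, has to be compared between charts.
-/

noncomputable section

namespace EinsteinFlow

/-! ### Traces, norms and pairings with respect to a metric matrix -/

section MatrixAlgebra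

open scoped Matrix

variable {n : ℕ}

theorem traceWith_eq_trace (g A : Matrix (Fin n) (Fin n) ℝ) :
    traceWith g A = (g⁻¹ * Aᵀ).trace := by
  simp [traceWith, Matrix.trace, Matrix.mul_apply]

theorem normSqWith_eq_trace (g A : Matrix (Fin n) (Fin n) ℝ) :
    normSqWith g A = (A * g⁻¹ * Aᵀ * g⁻¹ᵀ).trace := by
  simp only [normSqWith, Matrix.trace, Matrix.mul_apply, Matrix.diag_apply, Matrix.transpose_apply,
    Finset.sum_mul]
  refine Finset.sum_congr rfl fun i _ => ?_
  rw [Finset.sum_comm]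
  refine Finset.sum_congr rfl fun k _ => ?_
  rw [Finset.sum_comm]
  exact Finset.sum_congr rfl fun l _ => Finset.sum_congr rfl fun j _ => by ring

/-- The pairing `g^{ab} p_a q_b` of two covectors at a point. -/
def pairWith (g : Matrix (Fin n) (Fin n) ℝ) (p q : Fin n → ℝ) : ℝ :=
  ∑ a, ∑ b, g⁻¹ a b * p a * q b

theorem pairWith_eq_dotProduct (g : Matrix (Fin n) (Fin n) ℝ) (p q : Fin n → ℝ) :
    pairWith g p q = p ⬝ᵥ (g⁻¹ *ᵥ q) := by
  simp only [pairWith, dotProduct, Matrix.mulVec, Finset.mul_sum]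
  exact Finset.sum_congr rfl fun l _ => Finset.sum_congr rfl fun j _ => by ring

theorem traceWith_congruence (g A : Matrix (Fin n) (Fin n) ℝ) {J : Matrix (Fin n) (Fin n) ℝ}
    (hJ : IsUnit J.det) : traceWith (Jᵀ * g * J) (Jᵀ * A * J) = traceWith g A := by
  have hJt : IsUnit Jᵀ.det := by rwa [Matrix.det_transpose]
  rw [traceWith_eq_trace, traceWith_eq_trace]
  simp only [Matrix.mul_inv_rev, Matrix.transpose_mul, Matrix.transpose_transpose, Matrix.mul_assoc]
  rw [Matrix.nonsing_inv_mul_cancel_left _ _ hJt, Matrix.trace_mul_comm]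
  simp only [Matrix.mul_assoc]
  rw [Matrix.mul_nonsing_inv _ hJ, Matrix.mul_one]

theorem normSqWith_congruence (g A : Matrix (Fin n) (Fin n) ℝ) {J : Matrix (Fin n) (Fin n) ℝ}
    (hJ : IsUnit J.det) : normSqWith (Jᵀ * g * J) (Jᵀ * A * J) = normSqWith g A := by
  have hJt : IsUnit Jᵀ.det := by rwa [Matrix.det_transpose]
  rw [normSqWith_eq_trace, normSqWith_eq_trace]
  simp only [Matrix.mul_inv_rev, Matrix.transpose_mul, Matrix.transpose_transpose, Matrix.mul_assoc,
    Matrix.transpose_nonsing_inv]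
  rw [Matrix.nonsing_inv_mul_cancel_left _ _ hJt, Matrix.mul_nonsing_inv_cancel_left _ _ hJ,
    Matrix.mul_nonsing_inv_cancel_left _ _ hJ,
    Matrix.trace_mul_comm]
  simp only [Matrix.mul_assoc]
  rw [Matrix.nonsing_inv_mul _ hJt, Matrix.mul_one]

theorem pairWith_congruence (g : Matrix (Fin n) (Fin n) ℝ) {J : Matrix (Fin n) (Fin n) ℝ}
    (hJ : IsUnit J.det) (p q : Fin n → ℝ) :
    pairWith (Jᵀ * g * J) (Jᵀ *ᵥ p) (Jᵀ *ᵥ q) = pairWith g p q := by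
  have hJt : IsUnit Jᵀ.det := by rwa [Matrix.det_transpose]
  rw [pairWith_eq_dotProduct, pairWith_eq_dotProduct, Matrix.mulVec_transpose J p,
    ← Matrix.dotProduct_mulVec, Matrix.mulVec_mulVec, Matrix.mulVec_mulVec]
  simp only [Matrix.mul_inv_rev, Matrix.mul_assoc]
  rw [Matrix.nonsing_inv_mul _ hJt, Matrix.mul_one, Matrix.mul_nonsing_inv_cancel_left _ _ hJ]

/-- For `c = H / n` this expands the norm of the traceless part `K⁰ = K - (H/n) h`. -/
theorem normSqWith_sub_smul {g : Matrix (Fin n) (Fin n) ℝ} (hg : gᵀ = g) (hdet : IsUnit g.det)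
    (A : Matrix (Fin n) (Fin n) ℝ) (c : ℝ) :
    normSqWith g (A - c • g) = normSqWith g A - 2 * c * traceWith g A + c ^ 2 * n := by
  have hgi : g⁻¹ᵀ = g⁻¹ := by rw [Matrix.transpose_nonsing_inv, hg]
  simp only [normSqWith_eq_trace, traceWith_eq_trace, hgi, Matrix.transpose_sub,
    Matrix.transpose_smul, hg, Matrix.sub_mul, Matrix.mul_sub, Matrix.smul_mul, Matrix.mul_smul,
    Matrix.trace_sub, Matrix.trace_smul, Matrix.mul_nonsing_inv _ hdet, Matrix.one_mul,
    Matrix.mul_assoc, Matrix.nonsing_inv_mul _ hdet, Matrix.mul_one, Matrix.trace_one,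
    Fintype.card_fin, smul_eq_mul]
  have e1 : (A * g⁻¹).trace = (g⁻¹ * Aᵀ).trace := by
    rw [← Matrix.trace_transpose, Matrix.transpose_mul, hgi]
  have e2 : (Aᵀ * g⁻¹).trace = (g⁻¹ * Aᵀ).trace := Matrix.trace_mul_comm _ _
  simp only [e1, e2]
  ring

theorem inv_smul_matrix (g : Matrix (Fin n) (Fin n) ℝ) {c : ℝ} (hc : c ≠ 0) :
    (c • g)⁻¹ = c⁻¹ • g⁻¹ := by
  by_cases hg : IsUnit g.det
  · exact Matrix.inv_smul' g (Units.mk0 c hc) hg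
  · have : ¬ IsUnit (c • g).det := by
      simpa [Matrix.det_smul, hc] using hg
    rw [Matrix.nonsing_inv_apply_not_isUnit _ hg, Matrix.nonsing_inv_apply_not_isUnit _ this,
      smul_zero]

theorem traceWith_smul_left (g A : Matrix (Fin n) (Fin n) ℝ) {c : ℝ} (hc : c ≠ 0) :
    traceWith (c • g) A = c⁻¹ * traceWith g A := by
  simp [traceWith, inv_smul_matrix g hc, Finset.mul_sum, mul_assoc]

theorem normSqWith_smul_smul (g A : Matrix (Fin n) (Fin n) ℝ) {c : ℝ} (hc : c ≠ 0) (d : ℝ) :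
    normSqWith (c • g) (d • A) = (d * c⁻¹) ^ 2 * normSqWith g A := by
  simp only [normSqWith, inv_smul_matrix g hc, Finset.mul_sum, Matrix.smul_apply, smul_eq_mul]
  exact Finset.sum_congr rfl fun i _ => Finset.sum_congr rfl fun j _ => Finset.sum_congr rfl
    fun k _ => Finset.sum_congr rfl fun l _ => by ring

/-- The trace of a positive semidefinite form is nonnegative: write `g⁻¹` as a sum of rank-one
matrices `v vᵀ`. -/
theorem traceWith_nonneg {g A : Matrix (Fin n) (Fin n) ℝ} (hg : g.PosDef)
    (hA : ∀ v : Fin n → ℝ, 0 ≤ v ⬝ᵥ (A *ᵥ v)) : 0 ≤ traceWith g A := by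
  obtain ⟨m, v, hv⟩ := Matrix.posSemidef_iff_eq_sum_vecMulVec.1 hg.inv.posSemidef
  have : traceWith g A = ∑ k, v k ⬝ᵥ (A *ᵥ v k) := by
    simp only [traceWith, hv, Matrix.sum_apply, Matrix.vecMulVec_apply, dotProduct, Matrix.mulVec,
      Finset.sum_mul, Finset.mul_sum, star_trivial]
    rw [Finset.sum_congr rfl fun i _ => Finset.sum_comm, Finset.sum_comm]
    exact Finset.sum_congr rfl fun k _ => Finset.sum_congr rfl fun i _ =>
      Finset.sum_congr rfl fun j _ => by simp [mul_left_comm, mul_comm]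
  rw [this]
  exact Finset.sum_nonneg fun k _ => hA (v k)

theorem contDiff_det {k : WithTop ℕ∞} :
    ContDiff ℝ k (fun N : Fin n → Fin n → ℝ => (Matrix.of N).det) := by
  simp only [Matrix.det_apply, Matrix.of_apply]
  fun_prop

/-- **Jacobi's formula** for the derivative of the determinant. -/
theorem hasFDerivAt_det (M : Fin n → Fin n → ℝ) :
    HasFDerivAt (fun N : Fin n → Fin n → ℝ => (Matrix.of N).det)
      (∑ a, ∑ b, (Matrix.of M).adjugate b a •
        ((ContinuousLinearMap.proj b : (Fin n → ℝ) →L[ℝ] ℝ).comp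
          (ContinuousLinearMap.proj a : (Fin n → Fin n → ℝ) →L[ℝ] (Fin n → ℝ)))) M := by
  let D : ContinuousMultilinearMap ℝ (fun _ : Fin n => Fin n → ℝ) ℝ :=
    ⟨Matrix.detRowAlternating.toMultilinearMap, contDiff_det (k := 0).continuous⟩
  refine (D.hasFDerivAt M).congr_fderiv ?_
  ext N
  have h1 : ∀ a, D (Function.update M a (N a)) = ∑ b, (Matrix.of M).adjugate b a * N a b := by
    intro a
    change ((Matrix.of M).updateRow a (N a)).det = _
    rw [← Matrix.cramer_transpose_apply, Matrix.cramer_eq_adjugate_mulVec,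
      ← Matrix.adjugate_transpose]
    rfl
  simp [ContinuousMultilinearMap.linearDeriv_apply, h1]

open scoped Matrix.Norms.Operator in
/-- The derivative `d(M⁻¹) = - M⁻¹ dM M⁻¹` of the inverse, in components. -/
theorem hasFDerivAt_inv_apply {M : Fin n → Fin n → ℝ} (hM : IsUnit (Matrix.of M).det)
    (i j : Fin n) :
    HasFDerivAt (fun N : Fin n → Fin n → ℝ => (Matrix.of N)⁻¹ i j)
      (∑ a, ∑ b, (-((Matrix.of M)⁻¹ i a * (Matrix.of M)⁻¹ b j)) •
        ((ContinuousLinearMap.proj b : (Fin n → ℝ) →L[ℝ] ℝ).comp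
          (ContinuousLinearMap.proj a : (Fin n → Fin n → ℝ) →L[ℝ] (Fin n → ℝ)))) M := by
  let Φ : (Fin n → Fin n → ℝ) →L[ℝ] Matrix (Fin n) (Fin n) ℝ :=
    LinearMap.toContinuousLinearMap (Matrix.ofLinearEquiv ℝ).toLinearMap
  let e : Matrix (Fin n) (Fin n) ℝ →L[ℝ] ℝ :=
    LinearMap.toContinuousLinearMap (Matrix.entryLinearMap ℝ ℝ i j)
  obtain ⟨u, hu⟩ := (Matrix.isUnit_iff_isUnit_det _).2 hM
  have h1 := hasFDerivAt_ringInverse (𝕜 := ℝ) u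
  have hΦ : (u : Matrix (Fin n) (Fin n) ℝ) = Φ M := hu
  rw [hΦ] at h1
  have h2 := e.hasFDerivAt.comp M (h1.comp M Φ.hasFDerivAt)
  have h3 : (fun N : Fin n → Fin n → ℝ => (Matrix.of N)⁻¹ i j) = e ∘ Ring.inverse ∘ Φ := by
    ext N
    simp only [Function.comp_apply, ← Matrix.nonsing_inv_eq_ringInverse]
    rfl
  rw [h3]
  refine h2.congr_fderiv ?_
  ext N
  have hui : (↑u⁻¹ : Matrix (Fin n) (Fin n) ℝ) = (Matrix.of M)⁻¹ := by
    rw [← hu, ← Matrix.coe_units_inv]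
  simp only [hui]
  have h4 : (e.comp ((-((ContinuousLinearMap.mulLeftRight ℝ (Matrix (Fin n) (Fin n) ℝ))
      (Matrix.of M)⁻¹ (Matrix.of M)⁻¹)).comp Φ)) N
      = -((Matrix.of M)⁻¹ * Matrix.of N * (Matrix.of M)⁻¹) i j := rfl
  refine h4.trans ?_
  rw [Matrix.mul_apply]
  simp only [Matrix.mul_apply, Finset.sum_mul]
  rw [Finset.sum_comm, ← Finset.sum_neg_distrib]
  simp [mul_right_comm]

open scoped Matrix.Norms.Operator in
theorem contDiffAt_inv_apply {M : Fin n → Fin n → ℝ} (hM : IsUnit (Matrix.of M).det)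
    (i j : Fin n) {k : WithTop ℕ∞} :
    ContDiffAt ℝ k (fun N : Fin n → Fin n → ℝ => (Matrix.of N)⁻¹ i j) M := by
  let Φ : (Fin n → Fin n → ℝ) →L[ℝ] Matrix (Fin n) (Fin n) ℝ :=
    LinearMap.toContinuousLinearMap (Matrix.ofLinearEquiv ℝ).toLinearMap
  let e : Matrix (Fin n) (Fin n) ℝ →L[ℝ] ℝ :=
    LinearMap.toContinuousLinearMap (Matrix.entryLinearMap ℝ ℝ i j)
  obtain ⟨u, hu⟩ := (Matrix.isUnit_iff_isUnit_det _).2 hM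
  have h1 := contDiffAt_ringInverse ℝ u (n := k)
  have hΦ : (u : Matrix (Fin n) (Fin n) ℝ) = Φ M := hu
  rw [hΦ] at h1
  have h2 := e.contDiff.contDiffAt.comp M (h1.comp M Φ.contDiff.contDiffAt)
  have h3 : (fun N : Fin n → Fin n → ℝ => (Matrix.of N)⁻¹ i j) = e ∘ Ring.inverse ∘ Φ := by
    ext N
    simp only [Function.comp_apply, ← Matrix.nonsing_inv_eq_ringInverse]
    rfl
  rw [h3]
  exact h2

end MatrixAlgebra

/-! ### The Laplacian in coordinates -/

section CoordinateCalculus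

variable {n : ℕ}

theorem traceWith_eq_sum_symm {g : Matrix (Fin n) (Fin n) ℝ} (hg : g.transpose = g)
    (A : Matrix (Fin n) (Fin n) ℝ) : traceWith g A = ∑ a, ∑ b, g⁻¹ b a * A a b := by
  have hgi : g⁻¹.transpose = g⁻¹ := by rw [Matrix.transpose_nonsing_inv, hg]
  refine Finset.sum_congr rfl fun a _ => Finset.sum_congr rfl fun b _ => ?_
  rw [← congrFun (congrFun hgi a) b, Matrix.transpose_apply]

theorem adjugate_apply_eq_det_mul_inv {g : Matrix (Fin n) (Fin n) ℝ} (hg : IsUnit g.det)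
    (a b : Fin n) :
    g.adjugate a b = g.det * g⁻¹ a b := by
  rw [Matrix.inv_def, Matrix.smul_apply, smul_eq_mul, Ring.inverse_eq_inv',
    mul_inv_cancel_left₀ hg.ne_zero]

/-- The logarithmic derivative of the volume density: `∂√det g = ½ √det g · g^{ab} ∂g_{ab}`. -/
theorem hasFDerivAt_sqrt_det {M : Fin n → Fin n → ℝ} (hM : 0 < (Matrix.of M).det) :
    HasFDerivAt (fun N : Fin n → Fin n → ℝ => √(Matrix.of N).det)
      (∑ a, ∑ b, (1 / 2 * √(Matrix.of M).det * (Matrix.of M)⁻¹ b a) •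
        ((ContinuousLinearMap.proj b : (Fin n → ℝ) →L[ℝ] ℝ).comp
          (ContinuousLinearMap.proj a : (Fin n → Fin n → ℝ) →L[ℝ] (Fin n → ℝ)))) M := by
  refine ((hasFDerivAt_det M).sqrt hM.ne').congr_fderiv ?_
  simp only [Finset.smul_sum, smul_smul, adjugate_apply_eq_det_mul_inv hM.ne'.isUnit]
  refine Finset.sum_congr rfl fun a _ => Finset.sum_congr rfl fun b _ => ?_
  congr 1
  have h1 : √(Matrix.of M).det * √(Matrix.of M).det = (Matrix.of M).det :=
    Real.mul_self_sqrt hM.le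
  have h2 : √(Matrix.of M).det ≠ 0 := (Real.sqrt_pos.2 hM).ne'
  field_simp
  rw [sq, h1]

section Time

variable {G : ℝ → Matrix (Fin n) (Fin n) ℝ} {G' : Matrix (Fin n) (Fin n) ℝ} {s : Set ℝ} {t : ℝ}

theorem hasDerivWithinAt_sqrt_det (hG : ∀ i j, HasDerivWithinAt (fun τ => G τ i j) (G' i j) s t)
    (hpos : 0 < (G t).det) (hsymm : (G t).transpose = G t) :
    HasDerivWithinAt (fun τ => √(G τ).det) (1 / 2 * √(G t).det * traceWith (G t) G') s t := by
  have h1 : HasDerivWithinAt (fun τ => (fun i j => G τ i j : Fin n → Fin n → ℝ))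
      (fun i j => G' i j) s t :=
    hasDerivWithinAt_pi.2 fun i => hasDerivWithinAt_pi.2 fun j => hG i j
  have h2 := (hasFDerivAt_sqrt_det (M := fun i j => G t i j) hpos).comp_hasDerivWithinAt t h1
  refine h2.congr_deriv ?_
  rw [traceWith_eq_sum_symm hsymm]
  simp [Finset.mul_sum, mul_assoc]
  rfl

theorem hasDerivWithinAt_inv_apply
    (hG : ∀ i j, HasDerivWithinAt (fun τ => G τ i j) (G' i j) s t)
    (hdet : IsUnit (G t).det) (i j : Fin n) :
    HasDerivWithinAt (fun τ => (G τ)⁻¹ i j)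
      (-∑ a, ∑ b, (G t)⁻¹ i a * (G t)⁻¹ b j * G' a b) s t := by
  have h1 : HasDerivWithinAt (fun τ => (fun i j => G τ i j : Fin n → Fin n → ℝ))
      (fun i j => G' i j) s t :=
    hasDerivWithinAt_pi.2 fun i => hasDerivWithinAt_pi.2 fun j => hG i j
  have h2 := (hasFDerivAt_inv_apply (M := fun i j => G t i j) hdet i j).comp_hasDerivWithinAt t h1
  refine h2.congr_deriv ?_
  simp [mul_assoc]
  rfl

end Time

section Space

variable {g : EuclideanSpace ℝ (Fin n) → Matrix (Fin n) (Fin n) ℝ}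
  {f : EuclideanSpace ℝ (Fin n) → ℝ} {y : EuclideanSpace ℝ (Fin n)}

theorem fderiv_eq_sum_pd (f : EuclideanSpace ℝ (Fin n) → ℝ) (y v : EuclideanSpace ℝ (Fin n)) :
    fderiv ℝ f y v = ∑ j, v j * pd j f y := by
  have hv : v = ∑ j, v j • EuclideanSpace.single j (1 : ℝ) := by
    simpa using ((EuclideanSpace.basisFun (Fin n) ℝ).sum_repr v).symm
  conv_lhs => rw [hv]
  simp [pd, map_sum]

theorem pd_mul {a b : EuclideanSpace ℝ (Fin n) → ℝ} (ha : DifferentiableAt ℝ a y)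
    (hb : DifferentiableAt ℝ b y) (i : Fin n) :
    pd i (fun z => a z * b z) y = pd i a y * b y + a y * pd i b y := by
  simp [pd, fderiv_fun_mul ha hb]
  ring

theorem pd_sum {ι : Type*} {s : Finset ι} {a : ι → EuclideanSpace ℝ (Fin n) → ℝ}
    (ha : ∀ k ∈ s, DifferentiableAt ℝ (a k) y) (i : Fin n) :
    pd i (fun z => ∑ k ∈ s, a k z) y = ∑ k ∈ s, pd i (a k) y := by
  simp [pd, fderiv_fun_sum ha]

theorem hasFDerivAt_matrix (hg : ∀ a b, DifferentiableAt ℝ (fun z => g z a b) y) :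
    HasFDerivAt (fun z => (fun i j => g z i j : Fin n → Fin n → ℝ))
      (ContinuousLinearMap.pi fun i => ContinuousLinearMap.pi fun j =>
        fderiv ℝ (fun z => g z i j) y) y :=
  hasFDerivAt_pi.2 fun i => hasFDerivAt_pi.2 fun j => (hg i j).hasFDerivAt

theorem differentiableAt_sqrt_det (hg : ∀ a b, DifferentiableAt ℝ (fun z => g z a b) y)
    (hpos : 0 < (g y).det) : DifferentiableAt ℝ (fun z => √(g z).det) y := by
  have h := (hasFDerivAt_sqrt_det (M := fun i j => g y i j) hpos).comp y (hasFDerivAt_matrix hg)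
  exact h.differentiableAt

theorem differentiableAt_inv_apply (hg : ∀ a b, DifferentiableAt ℝ (fun z => g z a b) y)
    (hdet : IsUnit (g y).det) (i j : Fin n) : DifferentiableAt ℝ (fun z => (g z)⁻¹ i j) y := by
  have h := (hasFDerivAt_inv_apply (M := fun i j => g y i j) hdet i j).comp y
    (hasFDerivAt_matrix hg)
  exact h.differentiableAt

theorem pd_sqrt_det (hg : ∀ a b, DifferentiableAt ℝ (fun z => g z a b) y)
    (hpos : 0 < (g y).det) (hsymm : (g y).transpose = g y) (i : Fin n) :
    pd i (fun z => √(g z).det) y =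
      1 / 2 * √(g y).det * ∑ a, ∑ b, (g y)⁻¹ a b * pd i (fun z => g z a b) y := by
  have h2 := ((hasFDerivAt_sqrt_det (M := fun i j => g y i j) hpos).comp y
    (hasFDerivAt_matrix hg)).fderiv
  have h3 : pd i (fun z => √(g z).det) y = _ := congrArg (fun T => T (EuclideanSpace.single i 1)) h2
  rw [h3]
  have h4 := traceWith_eq_sum_symm hsymm (Matrix.of fun a b => pd i (fun z => g z a b) y)
  simp only [traceWith, Matrix.of_apply] at h4
  rw [h4]
  simp [Finset.mul_sum, mul_assoc, pd]
  rfl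

theorem pd_inv_apply (hg : ∀ a b, DifferentiableAt ℝ (fun z => g z a b) y)
    (hdet : IsUnit (g y).det) (i j k : Fin n) :
    pd k (fun z => (g z)⁻¹ i j) y =
      -∑ a, ∑ b, (g y)⁻¹ i a * (g y)⁻¹ b j * pd k (fun z => g z a b) y := by
  have h2 := ((hasFDerivAt_inv_apply (M := fun i j => g y i j) hdet i j).comp y
    (hasFDerivAt_matrix hg)).fderiv
  have h3 : pd k (fun z => (g z)⁻¹ i j) y = _ :=
    congrArg (fun T => T (EuclideanSpace.single k 1)) h2
  rw [h3]
  simp [mul_assoc, pd]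
  rfl

/-- The Laplacian `Δf = g^{ij} f_{;ij}` in coordinates. -/
def laplacian (g : EuclideanSpace ℝ (Fin n) → Matrix (Fin n) (Fin n) ℝ)
    (f : EuclideanSpace ℝ (Fin n) → ℝ) (y : EuclideanSpace ℝ (Fin n)) : ℝ :=
  traceWith (g y) (Matrix.of fun i j => hessian g f i j y)

/-- The contracted Christoffel symbols: `∂_i (√det g g^{ij}) = - √det g g^{kl} Γ^j_{kl}`. -/
theorem sum_pd_sqrt_det_mul_inv (hg : ∀ a b, DifferentiableAt ℝ (fun z => g z a b) y)
    (hpos : 0 < (g y).det) (hsymm : ∀ z, (g z).transpose = g z) (j : Fin n) :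
    ∑ i, pd i (fun z => √(g z).det * (g z)⁻¹ i j) y =
      -(√(g y).det * ∑ k, ∑ l, (g y)⁻¹ k l * christoffel g j k l y) := by
  have hinv : ∀ a b, (g y)⁻¹ a b = (g y)⁻¹ b a := fun a b => by
    have hgi : (g y)⁻¹.transpose = (g y)⁻¹ := by rw [Matrix.transpose_nonsing_inv, hsymm]
    exact congrFun (congrFun hgi b) a
  have hd : ∀ m a b, pd m (fun z => g z a b) y = pd m (fun z => g z b a) y := fun m a b => by
    congr 1; ext z; exact congrFun (congrFun (hsymm z) b) a
  simp only [pd_mul (differentiableAt_sqrt_det hg hpos)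
    (differentiableAt_inv_apply hg hpos.ne'.isUnit _ _), pd_sqrt_det hg hpos (hsymm y),
    pd_inv_apply hg hpos.ne'.isUnit, christoffel]
  set w := √(g y).det
  set γ := (g y)⁻¹
  set d : Fin n → Fin n → Fin n → ℝ := fun m a b => pd m (fun z => g z a b) y with hdd
  have hd' : ∀ m a b, d m a b = d m b a := hd
  change ∑ i, (1 / 2 * w * (∑ a, ∑ b, γ a b * d i a b) * γ i j
    + w * -∑ a, ∑ b, γ i a * γ b j * d i a b) = -(w * ∑ k, ∑ l, γ k l * (1 / 2 *
      ∑ m, γ j m * (d k l m + d l k m - d m k l)))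
  -- By symmetry of `g⁻¹`, the first two of the three terms of the Christoffel symbol contribute
  -- equally; they cancel the derivative of `g⁻¹`, and the third cancels that of `√det g`.
  have hT1 : ∑ k, ∑ l, ∑ m, γ k l * γ j m * d k l m = ∑ k, ∑ l, ∑ m, γ k l * γ j m * d l k m := by
    rw [Finset.sum_comm]
    exact Finset.sum_congr rfl fun k _ => Finset.sum_congr rfl fun l _ =>
      Finset.sum_congr rfl fun m _ => by rw [hinv l k]
  have hT3 : ∑ k, ∑ l, ∑ m, γ k l * γ j m * d m k l = ∑ m, ∑ k, ∑ l, γ k l * d m k l * γ m j := by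
    rw [Finset.sum_congr rfl fun k _ => Finset.sum_comm, Finset.sum_comm]
    exact Finset.sum_congr rfl fun m _ => Finset.sum_congr rfl fun k _ =>
      Finset.sum_congr rfl fun l _ => by rw [hinv m j]; ring
  have hR : ∑ k, ∑ l, γ k l * (1 / 2 * ∑ m, γ j m * (d k l m + d l k m - d m k l)) =
      1 / 2 * (∑ k, ∑ l, ∑ m, γ k l * γ j m * d k l m + ∑ k, ∑ l, ∑ m, γ k l * γ j m * d l k m -
        ∑ k, ∑ l, ∑ m, γ k l * γ j m * d m k l) := by
    simp only [Finset.mul_sum, ← Finset.sum_add_distrib, ← Finset.sum_sub_distrib]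
    exact Finset.sum_congr rfl fun k _ => Finset.sum_congr rfl fun l _ =>
      Finset.sum_congr rfl fun m _ => by ring
  rw [hR, ← hT1, hT3, Finset.sum_add_distrib]
  have e1 : ∑ i, 1 / 2 * w * (∑ a, ∑ b, γ a b * d i a b) * γ i j =
      1 / 2 * w * ∑ m, ∑ k, ∑ l, γ k l * d m k l * γ m j := by
    simp only [Finset.mul_sum, Finset.sum_mul]
    exact Finset.sum_congr rfl fun k _ => Finset.sum_congr rfl fun l _ =>
      Finset.sum_congr rfl fun m _ => by ring
  have e2 : ∑ i, w * -∑ a, ∑ b, γ i a * γ b j * d i a b =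
      -(w * ∑ k, ∑ l, ∑ m, γ k l * γ j m * d k l m) := by
    simp only [Finset.mul_sum, ← Finset.sum_neg_distrib]
    exact Finset.sum_congr rfl fun k _ => Finset.sum_congr rfl fun l _ =>
      Finset.sum_congr rfl fun m _ => by rw [hinv m j]; ring
  rw [e1, e2]
  ring

/-- The divergence form of the Laplacian: `√det g Δf = ∂_i (√det g g^{ij} ∂_j f)`. -/
theorem sum_pd_flux (hg : ∀ a b, DifferentiableAt ℝ (fun z => g z a b) y)
    (hpos : 0 < (g y).det) (hsymm : ∀ z, (g z).transpose = g z)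
    (hf : ∀ j, DifferentiableAt ℝ (pd j f) y) :
    ∑ i, pd i (fun z => ∑ j, √(g z).det * (g z)⁻¹ i j * pd j f z) y =
      √(g y).det * laplacian g f y := by
  have hw : ∀ i j, DifferentiableAt ℝ (fun z => √(g z).det * (g z)⁻¹ i j) y := fun i j =>
    (differentiableAt_sqrt_det hg hpos).mul (differentiableAt_inv_apply hg hpos.ne'.isUnit i j)
  have h1 : ∀ i, pd i (fun z => ∑ j, √(g z).det * (g z)⁻¹ i j * pd j f z) y =
      ∑ j, (pd i (fun z => √(g z).det * (g z)⁻¹ i j) y * pd j f y +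
        √(g y).det * (g y)⁻¹ i j * pd i (pd j f) y) := fun i => by
    rw [pd_sum (a := fun j z => √(g z).det * (g z)⁻¹ i j * pd j f z)
      fun j _ => (hw i j).mul (hf j)]
    exact Finset.sum_congr rfl fun j _ => pd_mul (hw i j) (hf j) i
  simp only [h1, Finset.sum_add_distrib]
  have h2 : ∑ i, ∑ j, pd i (fun z => √(g z).det * (g z)⁻¹ i j) y * pd j f y =
      -(√(g y).det * ∑ k, ∑ l, (g y)⁻¹ k l * ∑ j, christoffel g j k l y * pd j f y) := by
    rw [Finset.sum_comm]
    simp only [← Finset.sum_mul, sum_pd_sqrt_det_mul_inv hg hpos hsymm]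
    simp only [neg_mul, Finset.sum_neg_distrib, Finset.mul_sum, Finset.sum_mul]
    rw [neg_inj, Finset.sum_comm]
    refine Finset.sum_congr rfl fun k _ => ?_
    rw [Finset.sum_comm]
    exact Finset.sum_congr rfl fun l _ => Finset.sum_congr rfl fun j _ => by ring
  rw [h2, laplacian, traceWith]
  simp only [Matrix.of_apply, hessian, mul_sub, Finset.sum_sub_distrib, mul_assoc, ← Finset.mul_sum]
  ring

/-- At a local minimum, the Hessian is positive semidefinite, so the Laplacian is nonnegative. -/
theorem laplacian_nonneg_of_isLocalMin (hg : (g y).PosDef) (hf : ContDiffAt ℝ 2 f y)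
    (hmin : IsLocalMin f y) : 0 ≤ laplacian g f y := by
  have hcrit : ∀ k, pd k f y = 0 := fun k => by simp [pd, hmin.fderiv_eq_zero]
  have hev : ∀ᶠ z in 𝓝 y, DifferentiableAt ℝ f z :=
    (hf.eventually (by simp)).mono fun z hz => hz.differentiableAt (by simp)
  have hfd : DifferentiableAt ℝ (fderiv ℝ f) y :=
    (hf.fderiv_right (m := 1) (by norm_num)).differentiableAt (by simp)
  refine traceWith_nonneg hg fun v => ?_
  have hv : dotProduct v ((Matrix.of fun i j => hessian g f i j y).mulVec v) =
      fderiv ℝ (fderiv ℝ f) y (WithLp.toLp 2 v) (WithLp.toLp 2 v) := by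
    have h2 : ∀ i j, pd i (pd j f) y = fderiv ℝ (fderiv ℝ f) y (EuclideanSpace.single i 1)
        (EuclideanSpace.single j 1) := fun i j => by
      change fderiv ℝ (fun z => fderiv ℝ f z (EuclideanSpace.single j 1)) y _ = _
      rw [fderiv_clm_apply hfd (differentiableAt_const _)]
      simp
    have hV : (WithLp.toLp 2 v : EuclideanSpace ℝ (Fin n)) =
        ∑ j, v j • EuclideanSpace.single j (1 : ℝ) := by
      simpa using ((EuclideanSpace.basisFun (Fin n) ℝ).sum_repr (WithLp.toLp 2 v)).symm
    rw [hV]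
    simp only [dotProduct, Matrix.mulVec, Matrix.of_apply, hessian, hcrit, mul_zero,
      Finset.sum_const_zero, sub_zero, h2, map_sum, map_smul, sum_apply,
      smul_apply, smul_eq_mul, Finset.mul_sum]
    rw [Finset.sum_comm]
    exact Finset.sum_congr rfl fun i _ => Finset.sum_congr rfl fun j _ => by ring
  rw [hv]
  generalize (WithLp.toLp 2 v : EuclideanSpace ℝ (Fin n)) = V
  -- A negative second derivative along the line `y + s V` makes `0` a local maximum as well, so `f`
  -- is constant on that line near `y`, and its second derivative vanishes.
  by_contra! hneg
  have hline : ∀ s : ℝ, HasDerivAt (fun s : ℝ => y + s • V) V s := fun s => by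
    simpa using ((hasDerivAt_id s).smul_const V).const_add y
  have hcont : Filter.Tendsto (fun s : ℝ => y + s • V) (𝓝 0) (𝓝 y) := by
    simpa using (hline 0).continuousAt.tendsto
  have hd1 : ∀ᶠ s in 𝓝 (0 : ℝ), deriv (fun s : ℝ => f (y + s • V)) s =
      fderiv ℝ f (y + s • V) V := by
    filter_upwards [hcont.eventually hev] with s hs
    exact (hs.hasFDerivAt.comp_hasDerivAt s (hline s)).deriv
  have hd2 : deriv (deriv (fun s : ℝ => f (y + s • V))) 0 = fderiv ℝ (fderiv ℝ f) y V V := by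
    rw [Filter.EventuallyEq.deriv_eq hd1]
    have : HasFDerivAt (fderiv ℝ f) (fderiv ℝ (fderiv ℝ f) y) (y + (0:ℝ) • V) := by
      simpa using hfd.hasFDerivAt
    have h3 := this.comp_hasDerivAt (0 : ℝ) (hline 0)
    have h4 : HasDerivAt (fun s : ℝ => fderiv ℝ f (y + s • V) V) (fderiv ℝ (fderiv ℝ f) y V V) 0 :=
      ((ContinuousLinearMap.apply ℝ ℝ V).hasFDerivAt).comp_hasDerivAt (0 : ℝ) h3
    exact h4.deriv
  have hd0 : deriv (fun s : ℝ => f (y + s • V)) 0 = 0 := by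
    rw [hd1.self_of_nhds]; simp [hmin.fderiv_eq_zero]
  have hmax := isLocalMax_of_deriv_deriv_neg (hd2.trans_lt hneg) hd0 (by
    have : ContinuousAt f (y + (0:ℝ) • V) := by simpa using hf.continuousAt
    exact ContinuousAt.comp (f := fun s : ℝ => y + s • V) this (hline 0).continuousAt)
  have hconst : (fun s : ℝ => f (y + s • V)) =ᶠ[𝓝 0] fun _ => f y := by
    filter_upwards [hmax, hcont.eventually hmin] with s h1 h2
    simp only [zero_smul, add_zero] at h1
    exact le_antisymm h1 h2
  have : deriv (deriv (fun s : ℝ => f (y + s • V))) 0 = 0 := by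
    rw [hconst.deriv.deriv_eq]; simp
  rw [hd2] at this
  exact hneg.ne this

theorem continuous_mul_of_tsupport_subset {U : Set (EuclideanSpace ℝ (Fin n))} (hU : IsOpen U)
    {η c : EuclideanSpace ℝ (Fin n) → ℝ} (hη : Continuous η) (hsupp : tsupport η ⊆ U)
    (hc : ContinuousOn c U) : Continuous fun z => η z * c z := by
  refine continuous_iff_continuousAt.2 fun z => ?_
  by_cases hz : z ∈ U
  · exact hη.continuousAt.mul (hc.continuousAt (hU.mem_nhds hz))
  · have : (fun z => η z * c z) =ᶠ[𝓝 z] fun _ => 0 := by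
      filter_upwards [(isClosed_tsupport η).isOpen_compl.mem_nhds fun h => hz (hsupp h)] with w hw
      rw [image_eq_zero_of_notMem_tsupport hw, zero_mul]
    exact (continuousAt_const (y := (0 : ℝ))).congr this.symm

theorem integrable_mul_of_tsupport_subset {U : Set (EuclideanSpace ℝ (Fin n))} (hU : IsOpen U)
    {η c : EuclideanSpace ℝ (Fin n) → ℝ} (hη : Continuous η) (hcpt : HasCompactSupport η)
    (hsupp : tsupport η ⊆ U) (hc : ContinuousOn c U) : Integrable fun z => η z * c z :=
  (continuous_mul_of_tsupport_subset hU hη hsupp hc).integrable_of_hasCompactSupport hcpt.mul_right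

theorem contDiffOn_matrix {U : Set (EuclideanSpace ℝ (Fin n))} {k : WithTop ℕ∞}
    (hg : ∀ a b, ContDiffOn ℝ k (fun z => g z a b) U) :
    ContDiffOn ℝ k (fun z => (fun i j => g z i j : Fin n → Fin n → ℝ)) U :=
  contDiffOn_pi.2 fun i => contDiffOn_pi.2 fun j => hg i j

theorem contDiffOn_inv_apply {U : Set (EuclideanSpace ℝ (Fin n))} {k : WithTop ℕ∞}
    (hg : ∀ a b, ContDiffOn ℝ k (fun z => g z a b) U) (hdet : ∀ y ∈ U, IsUnit (g y).det)
    (i j : Fin n) : ContDiffOn ℝ k (fun z => (g z)⁻¹ i j) U := fun y hy =>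
  ContDiffAt.comp_contDiffWithinAt (g := fun N : Fin n → Fin n → ℝ => (Matrix.of N)⁻¹ i j) y
    (contDiffAt_inv_apply (M := fun i j => g y i j) (hdet y hy) i j) (contDiffOn_matrix hg y hy)

theorem contDiffOn_sqrt_det {U : Set (EuclideanSpace ℝ (Fin n))} {k : WithTop ℕ∞}
    (hg : ∀ a b, ContDiffOn ℝ k (fun z => g z a b) U) (hpos : ∀ y ∈ U, 0 < (g y).det) :
    ContDiffOn ℝ k (fun z => √(g z).det) U :=
  ((contDiff_det (n := n)).comp_contDiffOn (contDiffOn_matrix hg)).sqrt fun y hy => (hpos y hy).ne'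

theorem contDiffOn_pd {U : Set (EuclideanSpace ℝ (Fin n))} (hU : IsOpen U) {k m : WithTop ℕ∞}
    (hf : ContDiffOn ℝ m f U) (hkm : k + 1 ≤ m) (j : Fin n) : ContDiffOn ℝ k (pd j f) U :=
  (hf.fderiv_of_isOpen hU hkm).clm_apply contDiffOn_const

/-- Green's formula in coordinates, for a compactly supported test function `η`:
`∫ η Δf √det g = - ∫ g^{ab} ∂_a η ∂_b f √det g`. -/
theorem integral_mul_laplacian {U : Set (EuclideanSpace ℝ (Fin n))} (hU : IsOpen U)
    (hg : ∀ a b, ContDiffOn ℝ 1 (fun z => g z a b) U) (hpos : ∀ y ∈ U, 0 < (g y).det)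
    (hsymm : ∀ z, (g z).transpose = g z) (hf : ContDiffOn ℝ 2 f U)
    {η : EuclideanSpace ℝ (Fin n) → ℝ} (hη : ContDiff ℝ 1 η) (hcpt : HasCompactSupport η)
    (hsupp : tsupport η ⊆ U) :
    ∫ z, η z * (√(g z).det * laplacian g f z) =
      -∫ z, √(g z).det * pairWith (g z) (fun a => pd a η z) (fun b => pd b f z) := by
  let W : Fin n → EuclideanSpace ℝ (Fin n) → ℝ :=
    fun i z => ∑ j, √(g z).det * (g z)⁻¹ i j * pd j f z
  have hW : ∀ i, ContDiffOn ℝ 1 (W i) U := fun i => ContDiffOn.sum fun j _ =>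
    ((contDiffOn_sqrt_det hg hpos).mul
      (contDiffOn_inv_apply hg (fun y hy => (hpos y hy).ne'.isUnit) i j)).mul
      (contDiffOn_pd hU hf (by norm_num) j)
  have hWd : ∀ i, ∀ y ∈ U, DifferentiableAt ℝ (W i) y := fun i y hy =>
    ((hW i).contDiffAt (hU.mem_nhds hy)).differentiableAt (by simp)
  have hpdη : ∀ i, Continuous (pd i η) := fun i =>
    (hη.continuous_fderiv (by simp)).clm_apply continuous_const
  have hsub : ∀ i, tsupport (pd i η) ⊆ tsupport η := fun i => by
    refine closure_minimal (fun z hz => ?_) (isClosed_tsupport η)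
    by_contra hz'
    have h0 : fderiv ℝ η z = 0 := by
      by_contra h
      exact hz' (support_fderiv_subset ℝ h)
    exact hz (by simp [pd, h0])
  have hcpt' : ∀ i, HasCompactSupport (pd i η) := fun i =>
    hcpt.isCompact.of_isClosed_subset (isClosed_tsupport _) (hsub i)
  have hI1 : ∀ i, Integrable fun z => η z * pd i (W i) z := fun i =>
    integrable_mul_of_tsupport_subset hU hη.continuous hcpt hsupp
      (contDiffOn_pd (k := 0) hU (hW i) (by norm_num) i).continuousOn
  have hI2 : ∀ i, Integrable fun z => pd i η z * W i z := fun i =>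
    integrable_mul_of_tsupport_subset hU (hpdη i) (hcpt' i) ((hsub i).trans hsupp)
      (hW i).continuousOn
  have hibp : ∀ i, ∫ z, η z * pd i (W i) z = -∫ z, pd i η z * W i z := fun i =>
    integral_mul_fderiv_eq_neg_fderiv_mul_of_integrable (hI2 i) (hI1 i)
      (integrable_mul_of_tsupport_subset hU hη.continuous hcpt hsupp (hW i).continuousOn)
      (fun z _ => (hη.differentiable (by simp)) z) (fun z hz => hWd i z (hsupp hz))
  have hL : ∀ z, η z * (√(g z).det * laplacian g f z) = ∑ i, η z * pd i (W i) z := fun z => by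
    by_cases hz : z ∈ U
    · rw [← Finset.mul_sum, ← sum_pd_flux
        (fun a b => ((hg a b).contDiffAt (hU.mem_nhds hz)).differentiableAt (by simp))
        (hpos z hz) hsymm fun j => ((contDiffOn_pd (k := 1) hU hf (by norm_num) j).contDiffAt
          (hU.mem_nhds hz)).differentiableAt (by simp)]
    · have : η z = 0 := image_eq_zero_of_notMem_tsupport fun h => hz (hsupp h)
      simp [this]
  have hR : ∀ z, √(g z).det * pairWith (g z) (fun a => pd a η z) (fun b => pd b f z) =
      ∑ i, pd i η z * W i z := fun z => by
    simp only [pairWith, W, Finset.mul_sum]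
    exact Finset.sum_congr rfl fun i _ => Finset.sum_congr rfl fun j _ => by ring
  simp only [hL, hR]
  rw [integral_finsetSum _ fun i _ => hI1 i, integral_finsetSum _ fun i _ => hI2 i,
    ← Finset.sum_neg_distrib]
  exact Finset.sum_congr rfl fun i _ => hibp i

end Space

end CoordinateCalculus

/-! ### Change of charts -/

section Transition

variable {n : ℕ} {X : Type*} [TopologicalSpace X]

/-- The Jacobian matrix `∂(ψ ∘ φ⁻¹)^a / ∂y^i` of the change of coordinates from `φ` to `ψ`. -/
def jac (φ ψ : OpenPartialHomeomorph X (EuclideanSpace ℝ (Fin n)))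
    (y : EuclideanSpace ℝ (Fin n)) : Matrix (Fin n) (Fin n) ℝ :=
  Matrix.of fun a i => fderiv ℝ (ψ ∘ φ.symm) y (EuclideanSpace.single i 1) a

theorem det_jac (φ ψ : OpenPartialHomeomorph X (EuclideanSpace ℝ (Fin n)))
    (y : EuclideanSpace ℝ (Fin n)) : (jac φ ψ y).det = (fderiv ℝ (ψ ∘ φ.symm) y).det := by
  have h : jac φ ψ y = LinearMap.toMatrix (EuclideanSpace.basisFun (Fin n) ℝ).toBasis
      (EuclideanSpace.basisFun (Fin n) ℝ).toBasis (fderiv ℝ (ψ ∘ φ.symm) y).toLinearMap := by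
    ext a i
    simp [jac, LinearMap.toMatrix_apply]
  rw [h, LinearMap.det_toMatrix]

variable {φ ψ : OpenPartialHomeomorph X (EuclideanSpace ℝ (Fin n))} {y : EuclideanSpace ℝ (Fin n)}

theorem symm_transition_eventuallyEq (hy : y ∈ φ.target) (hyψ : φ.symm y ∈ ψ.source) :
    φ.symm =ᶠ[𝓝 y] ψ.symm ∘ (ψ ∘ φ.symm) := by
  filter_upwards [(φ.symm.trans ψ).open_source.mem_nhds (by simp [hy, hyψ])] with z hz
  have hz' : z ∈ φ.target ∧ φ.symm z ∈ ψ.source := by simpa using hz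
  exact (ψ.left_inv hz'.2).symm

theorem fderiv_transition_single (i : Fin n) :
    fderiv ℝ (ψ ∘ φ.symm) y (EuclideanSpace.single i 1) =
      ∑ a, jac φ ψ y a i • EuclideanSpace.single a (1 : ℝ) := by
  simpa [jac] using ((EuclideanSpace.basisFun (Fin n) ℝ).sum_repr
    (fderiv ℝ (ψ ∘ φ.symm) y (EuclideanSpace.single i 1))).symm

variable [ChartedSpace (EuclideanSpace ℝ (Fin n)) X] [IsManifold (𝓡 n) ∞ X]

theorem mdifferentiableAt_symm (hφ : φ ∈ atlas (EuclideanSpace ℝ (Fin n)) X) (hy : y ∈ φ.target) :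
    MDifferentiableAt (𝓡 n) (𝓡 n) φ.symm y :=
  haveI : IsManifold (𝓡 n) 1 X := IsManifold.of_le (n := ∞) (by simp)
  mdifferentiableAt_atlas_symm hφ hy

theorem mfderiv_symm_injective (hφ : φ ∈ atlas (EuclideanSpace ℝ (Fin n)) X) (hy : y ∈ φ.target) :
    Function.Injective (mfderiv (𝓡 n) (𝓡 n) φ.symm y) := by
  have : IsManifold (𝓡 n) 1 X := IsManifold.of_le (n := ∞) (by simp)
  exact (mdifferentiable_of_mem_atlas (I := 𝓡 n) hφ).symm.mfderiv_injective hy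

theorem mdifferentiableAt_chart (hψ : ψ ∈ atlas (EuclideanSpace ℝ (Fin n)) X) {x : X}
    (hx : x ∈ ψ.source) : MDifferentiableAt (𝓡 n) (𝓡 n) ψ x :=
  haveI : IsManifold (𝓡 n) 1 X := IsManifold.of_le (n := ∞) (by simp)
  mdifferentiableAt_atlas hψ hx

theorem differentiableAt_transition (hφ : φ ∈ atlas (EuclideanSpace ℝ (Fin n)) X)
    (hψ : ψ ∈ atlas (EuclideanSpace ℝ (Fin n)) X) (hy : y ∈ φ.target)
    (hyψ : φ.symm y ∈ ψ.source) : DifferentiableAt ℝ (ψ ∘ φ.symm) y :=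
  mdifferentiableAt_iff_differentiableAt.1
    ((mdifferentiableAt_chart hψ hyψ).comp y (mdifferentiableAt_symm hφ hy))

theorem mfderiv_symm_apply (hφ : φ ∈ atlas (EuclideanSpace ℝ (Fin n)) X)
    (hψ : ψ ∈ atlas (EuclideanSpace ℝ (Fin n)) X) (hy : y ∈ φ.target)
    (hyψ : φ.symm y ∈ ψ.source) (v : EuclideanSpace ℝ (Fin n)) :
    (mfderiv (𝓡 n) (𝓡 n) φ.symm y v : EuclideanSpace ℝ (Fin n)) =
      mfderiv (𝓡 n) (𝓡 n) ψ.symm (ψ (φ.symm y)) (fderiv ℝ (ψ ∘ φ.symm) y v) := by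
  have h1 : HasMFDerivAt (𝓡 n) (𝓡 n) (ψ ∘ φ.symm) y (fderiv ℝ (ψ ∘ φ.symm) y) :=
    (differentiableAt_transition hφ hψ hy hyψ).hasFDerivAt.hasMFDerivAt
  have h2 : MDifferentiableAt (𝓡 n) (𝓡 n) ψ.symm ((ψ ∘ φ.symm) y) :=
    mdifferentiableAt_symm hψ (ψ.map_source hyψ)
  have h3 := (h2.hasMFDerivAt.comp y h1).congr_of_eventuallyEq
    (symm_transition_eventuallyEq hy hyψ)
  have h4 := h3.mfderiv
  exact congrArg (fun T : EuclideanSpace ℝ (Fin n) →L[ℝ] EuclideanSpace ℝ (Fin n) => T v) h4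

theorem isUnit_det_jac (hφ : φ ∈ atlas (EuclideanSpace ℝ (Fin n)) X)
    (hψ : ψ ∈ atlas (EuclideanSpace ℝ (Fin n)) X) (hy : y ∈ φ.target)
    (hyψ : φ.symm y ∈ ψ.source) : IsUnit (jac φ ψ y).det := by
  rw [det_jac]
  have hinj : Function.Injective (fderiv ℝ (ψ ∘ φ.symm) y) := fun v w hvw => by
    refine mfderiv_symm_injective hφ hy ?_
    have hv := mfderiv_symm_apply hφ hψ hy hyψ v
    rw [hvw, ← mfderiv_symm_apply hφ hψ hy hyψ w] at hv
    exact hv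
  exact LinearMap.isUnit_iff_isUnit_det _ |>.1 ((LinearMap.isUnit_iff_ker_eq_bot _).2
    (LinearMap.ker_eq_bot.2 hinj))

/-- The transformation law `A_{ij} = ∂_i y'^a ∂_j y'^b A'_{ab}` of a covariant 2-tensor. -/
theorem comp_eq_congruence (hφ : φ ∈ atlas (EuclideanSpace ℝ (Fin n)) X)
    (hψ : ψ ∈ atlas (EuclideanSpace ℝ (Fin n)) X) (A : TwoTensor n X) (hy : y ∈ φ.target)
    (hyψ : φ.symm y ∈ ψ.source) :
    comp φ A y = (jac φ ψ y).transpose * comp ψ A (ψ (φ.symm y)) * jac φ ψ y := by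
  -- The two base points are equal but not definitionally so; on the model space, where all tangent
  -- spaces live, the transport is harmless.
  have key : ∀ (x x' : X) (_ : x = x') (v w : EuclideanSpace ℝ (Fin n)),
      (A x : EuclideanSpace ℝ (Fin n) →L[ℝ] EuclideanSpace ℝ (Fin n) →L[ℝ] ℝ) v w =
      (A x' : EuclideanSpace ℝ (Fin n) →L[ℝ] EuclideanSpace ℝ (Fin n) →L[ℝ] ℝ) v w := by
    rintro x _ rfl v w; rfl
  have h1 : ∀ i, (mfderiv (𝓡 n) (𝓡 n) φ.symm y (EuclideanSpace.single i (1 : ℝ)) :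
      EuclideanSpace ℝ (Fin n)) = ∑ a, jac φ ψ y a i •
        (mfderiv (𝓡 n) (𝓡 n) ψ.symm (ψ (φ.symm y)) (EuclideanSpace.single a (1 : ℝ)) :
          EuclideanSpace ℝ (Fin n)) := fun i => by
    rw [mfderiv_symm_apply hφ hψ hy hyψ, fderiv_transition_single]
    exact (map_sum (mfderiv (𝓡 n) (𝓡 n) ψ.symm (ψ (φ.symm y))) _ _).trans
      (Finset.sum_congr rfl fun j _ => map_smul _ _ _)
  ext i j
  have h2 : comp φ A y i j = (A (ψ.symm (ψ (φ.symm y))) :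
      EuclideanSpace ℝ (Fin n) →L[ℝ] EuclideanSpace ℝ (Fin n) →L[ℝ] ℝ)
      (mfderiv (𝓡 n) (𝓡 n) φ.symm y (EuclideanSpace.single i (1 : ℝ)))
      (mfderiv (𝓡 n) (𝓡 n) φ.symm y (EuclideanSpace.single j (1 : ℝ))) :=
    key _ _ (ψ.left_inv hyψ).symm _ _
  rw [h2, h1 i, h1 j]
  simp only [map_sum, map_smul, sum_apply, smul_apply,
    smul_eq_mul, Matrix.mul_apply, Matrix.transpose_apply, Finset.sum_mul, Finset.mul_sum]
  exact Finset.sum_congr rfl fun a _ => Finset.sum_congr rfl fun b _ => by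
    rw [comp, Matrix.of_apply]; ring

/-- The transformation law `∂_i f = ∂_i y'^a ∂'_a f` of a differential. -/
theorem pd_comp_symm (hφ : φ ∈ atlas (EuclideanSpace ℝ (Fin n)) X)
    (hψ : ψ ∈ atlas (EuclideanSpace ℝ (Fin n)) X) (hy : y ∈ φ.target)
    (hyψ : φ.symm y ∈ ψ.source) {f : X → ℝ}
    (hf : DifferentiableAt ℝ (f ∘ ψ.symm) (ψ (φ.symm y))) :
    (fun i => pd i (f ∘ φ.symm) y) =
      (jac φ ψ y).transpose.mulVec fun a => pd a (f ∘ ψ.symm) (ψ (φ.symm y)) := by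
  have h0 : f ∘ φ.symm =ᶠ[𝓝 y] (f ∘ ψ.symm) ∘ (ψ ∘ φ.symm) :=
    (symm_transition_eventuallyEq hy hyψ).fun_comp f
  ext i
  have h1 : HasFDerivAt ((f ∘ ψ.symm) ∘ (ψ ∘ φ.symm)) _ y :=
    HasFDerivAt.comp y (hf.hasFDerivAt) (differentiableAt_transition hφ hψ hy hyψ).hasFDerivAt
  rw [pd, h0.fderiv_eq, h1.fderiv, ContinuousLinearMap.comp_apply, fderiv_eq_sum_pd]
  rfl

theorem traceWith_comp_eq (hφ : φ ∈ atlas (EuclideanSpace ℝ (Fin n)) X)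
    (hψ : ψ ∈ atlas (EuclideanSpace ℝ (Fin n)) X) (g A : TwoTensor n X) {x : X}
    (hxφ : x ∈ φ.source) (hxψ : x ∈ ψ.source) :
    traceWith (comp φ g (φ x)) (comp φ A (φ x)) = traceWith (comp ψ g (ψ x)) (comp ψ A (ψ x)) := by
  have hx : φ.symm (φ x) = x := φ.left_inv hxφ
  have hy := φ.map_source hxφ
  have hyψ : φ.symm (φ x) ∈ ψ.source := by rwa [hx]
  rw [comp_eq_congruence hφ hψ g hy hyψ, comp_eq_congruence hφ hψ A hy hyψ,
    traceWith_congruence _ _ (isUnit_det_jac hφ hψ hy hyψ), hx]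

theorem normSqWith_comp_eq (hφ : φ ∈ atlas (EuclideanSpace ℝ (Fin n)) X)
    (hψ : ψ ∈ atlas (EuclideanSpace ℝ (Fin n)) X) (g A : TwoTensor n X) {x : X}
    (hxφ : x ∈ φ.source) (hxψ : x ∈ ψ.source) :
    normSqWith (comp φ g (φ x)) (comp φ A (φ x)) =
      normSqWith (comp ψ g (ψ x)) (comp ψ A (ψ x)) := by
  have hx : φ.symm (φ x) = x := φ.left_inv hxφ
  have hy := φ.map_source hxφ
  have hyψ : φ.symm (φ x) ∈ ψ.source := by rwa [hx]
  rw [comp_eq_congruence hφ hψ g hy hyψ, comp_eq_congruence hφ hψ A hy hyψ,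
    normSqWith_congruence _ _ (isUnit_det_jac hφ hψ hy hyψ), hx]

theorem pairWith_comp_eq (hφ : φ ∈ atlas (EuclideanSpace ℝ (Fin n)) X)
    (hψ : ψ ∈ atlas (EuclideanSpace ℝ (Fin n)) X) (g : TwoTensor n X) {x : X}
    (hxφ : x ∈ φ.source) (hxψ : x ∈ ψ.source) {f₁ f₂ : X → ℝ}
    (hf₁ : DifferentiableAt ℝ (f₁ ∘ ψ.symm) (ψ x)) (hf₂ : DifferentiableAt ℝ (f₂ ∘ ψ.symm) (ψ x)) :
    pairWith (comp φ g (φ x)) (fun a => pd a (f₁ ∘ φ.symm) (φ x))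
        (fun a => pd a (f₂ ∘ φ.symm) (φ x)) =
      pairWith (comp ψ g (ψ x)) (fun a => pd a (f₁ ∘ ψ.symm) (ψ x))
        (fun a => pd a (f₂ ∘ ψ.symm) (ψ x)) := by
  have hx : φ.symm (φ x) = x := φ.left_inv hxφ
  have hy := φ.map_source hxφ
  have hyψ : φ.symm (φ x) ∈ ψ.source := by rwa [hx]
  rw [comp_eq_congruence hφ hψ g hy hyψ, pd_comp_symm hφ hψ hy hyψ (by rwa [hx]),
    pd_comp_symm hφ hψ hy hyψ (by rwa [hx]),
    pairWith_congruence _ (isUnit_det_jac hφ hψ hy hyψ), hx]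

theorem transpose_comp_metric (h : Metric n X)
    (φ : OpenPartialHomeomorph X (EuclideanSpace ℝ (Fin n)))
    (y : EuclideanSpace ℝ (Fin n)) :
    (comp φ h.inner y).transpose = comp φ h.inner y := by
  ext i j
  exact h.symm _ _ _

theorem posDef_comp_metric (h : Metric n X) (hφ : φ ∈ atlas (EuclideanSpace ℝ (Fin n)) X)
    (hy : y ∈ φ.target) : (comp φ h.inner y).PosDef := by
  refine Matrix.PosDef.of_dotProduct_mulVec_pos (transpose_comp_metric h φ y) fun v hv => ?_
  have hV : (WithLp.toLp 2 v : EuclideanSpace ℝ (Fin n)) =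
      ∑ j, v j • EuclideanSpace.single j (1 : ℝ) := by
    simpa using ((EuclideanSpace.basisFun (Fin n) ℝ).sum_repr (WithLp.toLp 2 v)).symm
  have h0 : (mfderiv (𝓡 n) (𝓡 n) φ.symm y (WithLp.toLp 2 v)) ≠ 0 := by
    intro h0
    have h1 := mfderiv_symm_injective hφ hy (h0.trans (map_zero _).symm)
    exact hv (by ext i; exact congrArg (fun w : EuclideanSpace ℝ (Fin n) => w i) h1)
  have h1 := h.pos (φ.symm y) _ h0
  have h2 : mfderiv (𝓡 n) (𝓡 n) φ.symm y (WithLp.toLp 2 v) =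
      ∑ j, v j • mfderiv (𝓡 n) (𝓡 n) φ.symm y (EuclideanSpace.single j (1 : ℝ)) := by
    rw [hV]
    exact (map_sum (mfderiv (𝓡 n) (𝓡 n) φ.symm y) _ _).trans
      (Finset.sum_congr rfl fun j _ => map_smul _ _ _)
  rw [h2] at h1
  refine h1.trans_eq ?_
  simp only [map_sum, map_smul, sum_apply, smul_apply,
    smul_eq_mul, dotProduct, Matrix.mulVec, Finset.mul_sum, star_trivial]
  rw [Finset.sum_comm]
  exact Finset.sum_congr rfl fun a _ => Finset.sum_congr rfl fun b _ => by
    rw [comp, Matrix.of_apply]; ring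

end Transition

/-! ### The Riemannian volume measure -/

section Volume

variable {n : ℕ} {X : Type*} [TopologicalSpace X]

theorem aemeasurable_symm [MeasurableSpace X] [BorelSpace X]
    (φ : OpenPartialHomeomorph X (EuclideanSpace ℝ (Fin n))) :
    AEMeasurable φ.symm ((volume : Measure (EuclideanSpace ℝ (Fin n))).restrict φ.target) :=
  φ.continuousOn_symm.aemeasurable φ.open_target.measurableSet

theorem measurableSet_target_inter_preimage [MeasurableSpace X] [BorelSpace X]
    (φ : OpenPartialHomeomorph X (EuclideanSpace ℝ (Fin n))) {A : Set X} (hA : MeasurableSet A) :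
    MeasurableSet (φ.target ∩ φ.symm ⁻¹' A) := by
  have h1 : Measurable (φ.target.domRestrict φ.symm) :=
    (continuousOn_iff_continuous_domRestrict.1 φ.continuousOn_symm).measurable
  have h2 := MeasurableSet.subtype_image φ.open_target.measurableSet (h1 hA)
  convert h2 using 1
  ext y
  simp [and_comm]

variable [ChartedSpace (EuclideanSpace ℝ (Fin n)) X]

/-- The components of the tensor field `A` are continuous in every chart of the atlas. -/
def ContinuousComponents (A : TwoTensor n X) : Prop :=
  ∀ φ ∈ atlas (EuclideanSpace ℝ (Fin n)) X, ∀ i j, ContinuousOn (fun y => comp φ A y i j) φ.target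

/-- The volume density `√det g_{ij}` in the chart `φ`. -/
def volDensity (φ : OpenPartialHomeomorph X (EuclideanSpace ℝ (Fin n))) (g : TwoTensor n X)
    (y : EuclideanSpace ℝ (Fin n)) : ℝ :=
  √(comp φ g y).det

variable {φ ψ : OpenPartialHomeomorph X (EuclideanSpace ℝ (Fin n))}

theorem ContinuousComponents.continuousOn_volDensity {g : TwoTensor n X}
    (hg : ContinuousComponents g) (hφ : φ ∈ atlas (EuclideanSpace ℝ (Fin n)) X) :
    ContinuousOn (volDensity φ g) φ.target := by
  have h1 : ContinuousOn (fun y => (fun i j => comp φ g y i j : Fin n → Fin n → ℝ)) φ.target :=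
    continuousOn_pi.2 fun i => continuousOn_pi.2 fun j => hg φ hφ i j
  exact ((contDiff_det (k := 0)).continuous.comp_continuousOn h1).sqrt

/-- A countable cover by charts that starts with a given chart: the pieces obtained from it by
`disjointed` then start with the domain of that chart. -/
theorem exists_countable_atlas_cover [CompactSpace X]
    (hφ : φ ∈ atlas (EuclideanSpace ℝ (Fin n)) X) :
    ∃ c : ℕ → OpenPartialHomeomorph X (EuclideanSpace ℝ (Fin n)),
      c 0 = φ ∧ (∀ i, c i ∈ atlas (EuclideanSpace ℝ (Fin n)) X) ∧ ⋃ i, (c i).source = Set.univ := by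
  obtain ⟨t, ht⟩ := CompactSpace.elim_nhds_subcover
    (fun x : X => (chartAt (EuclideanSpace ℝ (Fin n)) x).source) fun x => chart_source_mem_nhds _ x
  rcases t.eq_empty_or_nonempty with rfl | hne
  · refine ⟨fun _ => φ, rfl, fun _ => hφ, ?_⟩
    have : IsEmpty X := by
      rw [← Set.univ_eq_empty_iff]; simpa using ht.symm
    exact Subsingleton.elim _ _
  · obtain ⟨f, hf⟩ := t.countable_toSet.exists_eq_range hne
    refine ⟨fun i => Nat.casesOn i φ fun k => chartAt (EuclideanSpace ℝ (Fin n)) (f k), rfl, ?_, ?_⟩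
    · rintro (_ | k)
      · exact hφ
      · exact chart_mem_atlas _ _
    · refine Set.eq_univ_of_forall fun x => ?_
      have hx : x ∈ ⋃ x ∈ t, (chartAt (EuclideanSpace ℝ (Fin n)) x).source := by rw [ht]; trivial
      simp only [Set.mem_iUnion] at hx ⊢
      obtain ⟨z, hz, hxz⟩ := hx
      obtain ⟨k, rfl⟩ : z ∈ Set.range f := hf ▸ hz
      exact ⟨k + 1, hxz⟩

theorem volDensity_eq [IsManifold (𝓡 n) ∞ X]
    (hφ : φ ∈ atlas (EuclideanSpace ℝ (Fin n)) X)
    (hψ : ψ ∈ atlas (EuclideanSpace ℝ (Fin n)) X) (g : TwoTensor n X)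
    {y : EuclideanSpace ℝ (Fin n)} (hy : y ∈ φ.target) (hyψ : φ.symm y ∈ ψ.source) :
    volDensity φ g y =
      |(fderiv ℝ (ψ ∘ φ.symm) y).det| * volDensity ψ g (ψ (φ.symm y)) := by
  rw [volDensity, comp_eq_congruence hφ hψ g hy hyψ, Matrix.det_mul, Matrix.det_mul,
    Matrix.det_transpose, ← det_jac, volDensity]
  have : (jac φ ψ y).det * (comp ψ g (ψ (φ.symm y))).det * (jac φ ψ y).det =
      (jac φ ψ y).det ^ 2 * (comp ψ g (ψ (φ.symm y))).det := by ring
  rw [this, Real.sqrt_mul (sq_nonneg _), Real.sqrt_sq_eq_abs]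

theorem ContinuousComponents.aemeasurable_volDensity {g : TwoTensor n X}
    (hg : ContinuousComponents g)
    (hφ : φ ∈ atlas (EuclideanSpace ℝ (Fin n)) X) :
    AEMeasurable (fun y => ENNReal.ofReal (volDensity φ g y))
      ((volume : Measure (EuclideanSpace ℝ (Fin n))).restrict φ.target) :=
  ((hg.continuousOn_volDensity hφ).aemeasurable φ.open_target.measurableSet).ennreal_ofReal

theorem ext_of_restrict_source [CompactSpace X] [MeasurableSpace X] {μ ν : Measure X}
    (h : ∀ φ ∈ atlas (EuclideanSpace ℝ (Fin n)) X, μ.restrict φ.source = ν.restrict φ.source) :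
    μ = ν := by
  rcases isEmpty_or_nonempty X with hX | ⟨⟨x⟩⟩
  · exact Subsingleton.elim _ _
  obtain ⟨c, -, hc, hcov⟩ :=
    exists_countable_atlas_cover (chart_mem_atlas (EuclideanSpace ℝ (Fin n)) x)
  rw [← Measure.restrict_univ (μ := μ), ← Measure.restrict_univ (μ := ν), ← hcov]
  exact Measure.restrict_iUnion_congr.2 fun i => h _ (hc i)

theorem chartVol_eq_map [MeasurableSpace X] (φ : OpenPartialHomeomorph X (EuclideanSpace ℝ (Fin n)))
    (g : TwoTensor n X) : chartVol φ g =
      (((volume : Measure (EuclideanSpace ℝ (Fin n))).restrict φ.target).withDensity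
        fun y => ENNReal.ofReal (volDensity φ g y)).map φ.symm := rfl

variable [MeasurableSpace X] [BorelSpace X]

theorem lintegral_chartVol {g : TwoTensor n X} (hg : ContinuousComponents g)
    (hφ : φ ∈ atlas (EuclideanSpace ℝ (Fin n)) X)
    {f : X → ℝ≥0∞} (hf : Measurable f) :
    ∫⁻ x, f x ∂(chartVol φ g) =
      ∫⁻ y in φ.target, ENNReal.ofReal (volDensity φ g y) * f (φ.symm y) := by
  rw [chartVol_eq_map, lintegral_map' hf.aemeasurable
    ((aemeasurable_symm φ).mono_ac (withDensity_absolutelyContinuous _ _)),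
    lintegral_withDensity_eq_lintegral_mul₀ (hg.aemeasurable_volDensity hφ)
      (g := fun y => f (φ.symm y)) (hf.comp_aemeasurable (aemeasurable_symm φ))]
  rfl

theorem chartVol_apply {g : TwoTensor n X} (hg : ContinuousComponents g)
    (hφ : φ ∈ atlas (EuclideanSpace ℝ (Fin n)) X)
    {A : Set X} (hA : MeasurableSet A) :
    chartVol φ g A =
      ∫⁻ y in φ.target ∩ φ.symm ⁻¹' A, ENNReal.ofReal (volDensity φ g y) := by
  rw [← lintegral_indicator_one hA, lintegral_chartVol hg hφ (measurable_one.indicator hA),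
    ← lintegral_indicator φ.open_target.measurableSet,
    ← lintegral_indicator (measurableSet_target_inter_preimage φ hA)]
  congr 1
  ext y
  by_cases h1 : y ∈ φ.target <;> by_cases h2 : φ.symm y ∈ A <;> simp [h1, h2]

theorem chartVol_compl_source {g : TwoTensor n X} (hg : ContinuousComponents g)
    (hφ : φ ∈ atlas (EuclideanSpace ℝ (Fin n)) X) :
    chartVol φ g φ.sourceᶜ = 0 := by
  rw [chartVol_apply hg hφ φ.open_source.measurableSet.compl]
  have : φ.target ∩ φ.symm ⁻¹' φ.sourceᶜ = ∅ := by
    ext y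
    simpa using fun hy => φ.map_target hy
  rw [this, setLIntegral_empty]

theorem chartVol_inter_source {g : TwoTensor n X} (hg : ContinuousComponents g)
    (hφ : φ ∈ atlas (EuclideanSpace ℝ (Fin n)) X)
    {A : Set X} : chartVol φ g (A ∩ φ.source) = chartVol φ g A :=
  measure_inter_conull (chartVol_compl_source hg hφ)

variable [IsManifold (𝓡 n) ∞ X]

/-- The chart measures agree on the overlap of two charts: this is the change of variables
formula. -/
theorem chartVol_eq_of_subset {g : TwoTensor n X} (hg : ContinuousComponents g)
    (hφ : φ ∈ atlas (EuclideanSpace ℝ (Fin n)) X) (hψ : ψ ∈ atlas (EuclideanSpace ℝ (Fin n)) X)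
    {A : Set X} (hA : MeasurableSet A) (hAφ : A ⊆ φ.source) (hAψ : A ⊆ ψ.source) :
    chartVol φ g A = chartVol ψ g A := by
  rw [chartVol_apply hg hφ hA, chartVol_apply hg hψ hA]
  set S := φ.target ∩ φ.symm ⁻¹' A with hS
  have himg : ψ.target ∩ ψ.symm ⁻¹' A = (ψ ∘ φ.symm) '' S := by
    ext z
    constructor
    · rintro ⟨hz, hzA⟩
      refine ⟨φ (ψ.symm z), ⟨φ.map_source (hAφ hzA), ?_⟩, ?_⟩
      · rw [Set.mem_preimage, φ.left_inv (hAφ hzA)]; exact hzA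
      · simp [φ.left_inv (hAφ hzA), ψ.right_inv hz]
    · rintro ⟨y, ⟨hy, hyA⟩, rfl⟩
      refine ⟨ψ.map_source (hAψ hyA), ?_⟩
      simp only [Function.comp_apply, Set.mem_preimage]
      rw [ψ.left_inv (hAψ hyA)]; exact hyA
  have hinj : Set.InjOn (ψ ∘ φ.symm) S := fun y hy z hz hyz =>
    φ.symm.injOn hy.1 hz.1 (ψ.injOn (hAψ hy.2) (hAψ hz.2) hyz)
  have hSm : MeasurableSet S := measurableSet_target_inter_preimage φ hA
  rw [himg, lintegral_image_eq_lintegral_abs_det_fderiv_mul volume hSm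
    (fun y hy => (differentiableAt_transition hφ hψ hy.1 (hAψ hy.2)).hasFDerivAt.hasFDerivWithinAt)
    hinj]
  refine setLIntegral_congr_fun hSm fun y hy => ?_
  simp only [volDensity_eq hφ hψ g hy.1 (hAψ hy.2)]
  rw [ENNReal.ofReal_mul (abs_nonneg _)]
  rfl

section Compact

variable [CompactSpace X]

/-- On the domain of a chart, the Riemannian volume measure is the chart measure. -/
theorem restrict_dvol {g : TwoTensor n X} (hg : ContinuousComponents g)
    (hφ : φ ∈ atlas (EuclideanSpace ℝ (Fin n)) X) :
    (dvol g).restrict φ.source = chartVol φ g := by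
  obtain ⟨c, hc0, hc, hcov⟩ := exists_countable_atlas_cover hφ
  set S : ℕ → Set X := disjointed fun i => (c i).source with hS
  have hSm : ∀ i, MeasurableSet (S i) :=
    fun i => MeasurableSet.disjointed (fun i => (c i).open_source.measurableSet) i
  have hSsub : ∀ i, S i ⊆ (c i).source := fun i => disjointed_subset _ i
  have hSdisj : Pairwise (Function.onFun Disjoint S) := disjoint_disjointed _
  have hSU : ⋃ i, S i = Set.univ := by rw [hS, iUnion_disjointed, hcov]
  -- Gluing along the disjoint pieces `S i` gives a measure that dominates every chart measure.
  have hle : dvol g ≤ Measure.sum fun i => (chartVol (c i) g).restrict (S i) := by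
    refine iSup₂_le fun ψ hψ => Measure.le_iff.2 fun B hB => ?_
    rw [Measure.sum_apply _ hB]
    have hB' : B = ⋃ i, B ∩ S i := by rw [← Set.inter_iUnion, hSU, Set.inter_univ]
    conv_lhs => rw [hB']
    refine (measure_iUnion_le _).trans (ENNReal.tsum_le_tsum fun i => ?_)
    rw [Measure.restrict_apply hB, ← chartVol_inter_source hg hψ,
      chartVol_eq_of_subset hg hψ (hc i) ((hB.inter (hSm i)).inter ψ.open_source.measurableSet)
        Set.inter_subset_right fun x hx => hSsub i hx.1.2]
    exact measure_mono Set.inter_subset_left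
  have hS0 : S 0 = φ.source := by simp [hS, hc0]
  refine Measure.ext fun A hA => ?_
  rw [Measure.restrict_apply hA, ← chartVol_inter_source hg hφ]
  have hAm := hA.inter φ.open_source.measurableSet
  refine le_antisymm ?_ ((le_iSup₂_of_le φ hφ le_rfl : chartVol φ g ≤ dvol g) _)
  refine (hle _).trans ?_
  rw [Measure.sum_apply _ hAm, tsum_eq_single 0]
  · rw [Measure.restrict_apply hAm, hc0]
    exact measure_mono Set.inter_subset_left
  · intro i hi
    rw [Measure.restrict_apply hAm]
    have : A ∩ φ.source ∩ S i = ∅ := by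
      rw [← hS0]
      have := Set.disjoint_iff_inter_eq_empty.1 (hSdisj hi.symm)
      rw [Set.inter_assoc, this, Set.inter_empty]
    simp [this]

theorem isFiniteMeasure_dvol {g : TwoTensor n X} (hg : ContinuousComponents g) :
    IsFiniteMeasure (dvol g) := by
  refine ⟨isCompact_univ.measure_lt_top_of_nhdsWithin fun x _ => ?_⟩
  rw [nhdsWithin_univ]
  set φ := chartAt (EuclideanSpace ℝ (Fin n)) x
  have hφ : φ ∈ atlas (EuclideanSpace ℝ (Fin n)) X := chart_mem_atlas _ x
  have hx : x ∈ φ.source := mem_chart_source _ x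
  have hy : φ x ∈ φ.target := φ.map_source hx
  have hcont : ContinuousAt (volDensity φ g) (φ x) :=
    (hg.continuousOn_volDensity hφ).continuousAt (φ.open_target.mem_nhds hy)
  have hev : ∀ᶠ y in 𝓝 (φ x), volDensity φ g y < volDensity φ g (φ x) + 1 :=
    hcont.eventually_lt continuousAt_const (lt_add_one _)
  obtain ⟨r, hr, hball⟩ := Metric.eventually_nhds_iff_ball.1 hev
  refine ⟨φ.source ∩ φ ⁻¹' Metric.ball (φ x) r,
    Filter.inter_mem (φ.open_source.mem_nhds hx)
      ((φ.continuousAt hx) (Metric.ball_mem_nhds _ hr)), ?_⟩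
  have hm : MeasurableSet (φ.source ∩ φ ⁻¹' Metric.ball (φ x) r) :=
    (φ.continuousOn.isOpen_inter_preimage φ.open_source Metric.isOpen_ball).measurableSet
  have h1 : dvol g (φ.source ∩ φ ⁻¹' Metric.ball (φ x) r) =
      chartVol φ g (φ.source ∩ φ ⁻¹' Metric.ball (φ x) r) := by
    rw [← restrict_dvol hg hφ, Measure.restrict_apply hm, Set.inter_eq_left.2 Set.inter_subset_left]
  have hsub : φ.target ∩ φ.symm ⁻¹' (φ.source ∩ φ ⁻¹' Metric.ball (φ x) r) ⊆
      Metric.ball (φ x) r := by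
    rintro y ⟨hyt, -, hyb⟩
    simpa [φ.right_inv hyt] using hyb
  rw [h1, chartVol_apply hg hφ hm]
  calc _ ≤ ∫⁻ _ in φ.target ∩ φ.symm ⁻¹' (φ.source ∩ φ ⁻¹' Metric.ball (φ x) r),
        ENNReal.ofReal (volDensity φ g (φ x) + 1) :=
        setLIntegral_mono' (measurableSet_target_inter_preimage φ hm) fun y hyS =>
          ENNReal.ofReal_le_ofReal (hball y (hsub hyS)).le
    _ ≤ ENNReal.ofReal (volDensity φ g (φ x) + 1) * volume (Metric.ball (φ x) r) := by
        rw [setLIntegral_const]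
        exact mul_le_mul_right (measure_mono hsub) _
    _ < ⊤ := ENNReal.mul_lt_top ENNReal.ofReal_lt_top measure_ball_lt_top

/-- If the volume densities of two metrics have, in every chart, the ratio `ρ`, then `ρ` is the
density of one volume measure with respect to the other. -/
theorem dvol_eq_withDensity {g₀ g : TwoTensor n X} (hg₀ : ContinuousComponents g₀)
    (hg : ContinuousComponents g) {ρ : X → ℝ} (hρ : Measurable ρ) (hρ0 : ∀ x, 0 ≤ ρ x)
    (h : ∀ φ ∈ atlas (EuclideanSpace ℝ (Fin n)) X, ∀ x ∈ φ.source,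
      volDensity φ g (φ x) = ρ x * volDensity φ g₀ (φ x)) :
    dvol g = (dvol g₀).withDensity fun x => ENNReal.ofReal (ρ x) := by
  refine ext_of_restrict_source (n := n) fun φ hφ => ?_
  rw [restrict_withDensity φ.open_source.measurableSet, restrict_dvol hg hφ, restrict_dvol hg₀ hφ]
  refine Measure.ext fun A hA => ?_
  rw [withDensity_apply _ hA, ← lintegral_indicator hA,
    lintegral_chartVol hg₀ hφ (hρ.ennreal_ofReal.indicator hA), ← lintegral_indicator_one hA,
    lintegral_chartVol hg hφ (measurable_one.indicator hA)]
  refine setLIntegral_congr_fun φ.open_target.measurableSet fun y hy => ?_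
  by_cases hyA : φ.symm y ∈ A
  · have h1 := h φ hφ (φ.symm y) (φ.map_target hy)
    rw [φ.right_inv hy] at h1
    simp only [hyA, Set.indicator_of_mem, h1, Pi.one_apply, mul_one]
    rw [ENNReal.ofReal_mul (hρ0 _), mul_comm]
  · simp [hyA]

/-- The integral over `X` of a function that vanishes outside the domain of a chart, in
coordinates. -/
theorem integral_dvol_eq {g : TwoTensor n X} (hg : ContinuousComponents g)
    (hφ : φ ∈ atlas (EuclideanSpace ℝ (Fin n)) X) {f : X → ℝ} (hf : Measurable f)
    (hf0 : ∀ x, x ∉ φ.source → f x = 0) :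
    ∫ x, f x ∂(dvol g) = ∫ y in φ.target, volDensity φ g y * f (φ.symm y) := by
  rw [← setIntegral_eq_integral_of_forall_compl_eq_zero (s := φ.source) fun x hx => hf0 x hx,
    restrict_dvol hg hφ, chartVol_eq_map, integral_map
      ((aemeasurable_symm φ).mono_ac (withDensity_absolutelyContinuous _ _))
      hf.aestronglyMeasurable,
    integral_withDensity_eq_integral_toReal_smul₀ (hg.aemeasurable_volDensity hφ)
      (by simp)]
  refine integral_congr_ae (Filter.Eventually.of_forall fun y => ?_)
  simp only [smul_eq_mul]
  rw [ENNReal.toReal_ofReal (show 0 ≤ volDensity φ g y from Real.sqrt_nonneg _)]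

end Compact

end Volume

/-! ### The divergence theorem -/

section Divergence

variable {n : ℕ} {X : Type*} [TopologicalSpace X]
  {φ : OpenPartialHomeomorph X (EuclideanSpace ℝ (Fin n))}

section ExtendByZero

variable {η : X → ℝ}

theorem support_indicator_subset (φ : OpenPartialHomeomorph X (EuclideanSpace ℝ (Fin n)))
    (η : X → ℝ) :
    Function.support (φ.target.indicator (η ∘ φ.symm)) ⊆ φ '' (φ.source ∩ tsupport η) := by
  intro y hy
  have hy1 : y ∈ φ.target := by
    by_contra h; exact hy (by simp [h])
  refine ⟨φ.symm y, ⟨φ.map_target hy1, subset_tsupport _ ?_⟩, φ.right_inv hy1⟩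
  rwa [Function.mem_support, Set.indicator_of_mem hy1] at hy

theorem isCompact_image_tsupport [CompactSpace X] (hsupp : tsupport η ⊆ φ.source) :
    IsCompact (φ '' (φ.source ∩ tsupport η)) := by
  rw [Set.inter_eq_right.2 hsupp]
  exact (isClosed_tsupport η).isCompact.image_of_continuousOn (φ.continuousOn.mono hsupp)

theorem tsupport_indicator_subset [CompactSpace X] (hsupp : tsupport η ⊆ φ.source) :
    tsupport (φ.target.indicator (η ∘ φ.symm)) ⊆ φ '' (φ.source ∩ tsupport η) :=
  closure_minimal (support_indicator_subset φ η) (isCompact_image_tsupport hsupp).isClosed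

theorem hasCompactSupport_indicator [CompactSpace X] (hsupp : tsupport η ⊆ φ.source) :
    HasCompactSupport (φ.target.indicator (η ∘ φ.symm)) :=
  (isCompact_image_tsupport hsupp).of_isClosed_subset (isClosed_tsupport _)
    (tsupport_indicator_subset hsupp)

theorem tsupport_indicator_subset_target [CompactSpace X] (hsupp : tsupport η ⊆ φ.source) :
    tsupport (φ.target.indicator (η ∘ φ.symm)) ⊆ φ.target := by
  refine (tsupport_indicator_subset hsupp).trans ?_
  rintro _ ⟨x, ⟨hx, -⟩, rfl⟩
  exact φ.map_source hx

theorem indicator_eventuallyEq {y : EuclideanSpace ℝ (Fin n)} (hy : y ∈ φ.target) :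
    φ.target.indicator (η ∘ φ.symm) =ᶠ[𝓝 y] η ∘ φ.symm := by
  filter_upwards [φ.open_target.mem_nhds hy] with z hz
  rw [Set.indicator_of_mem hz]

theorem contDiff_indicator [CompactSpace X] (hsupp : tsupport η ⊆ φ.source)
    (hη : ContDiffOn ℝ 1 (η ∘ φ.symm) φ.target) :
    ContDiff ℝ 1 (φ.target.indicator (η ∘ φ.symm)) := by
  refine contDiff_iff_contDiffAt.2 fun y => ?_
  by_cases hy : y ∈ φ.target
  · exact (hη.contDiffAt (φ.open_target.mem_nhds hy)).congr_of_eventuallyEq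
      (indicator_eventuallyEq hy)
  · have h0 : φ.target.indicator (η ∘ φ.symm) =ᶠ[𝓝 y] fun _ => 0 :=
      notMem_tsupport_iff_eventuallyEq.1 fun h => hy (tsupport_indicator_subset_target hsupp h)
    exact contDiffAt_const.congr_of_eventuallyEq h0

end ExtendByZero

variable [ChartedSpace (EuclideanSpace ℝ (Fin n)) X]

/-- The components of the tensor field `A` are of class `C¹` in every chart of the atlas. -/
def C1Components (A : TwoTensor n X) : Prop :=
  ∀ φ ∈ atlas (EuclideanSpace ℝ (Fin n)) X, ∀ i j,
    ContDiffOn ℝ 1 (fun y => comp φ A y i j) φ.target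

theorem C1Components.continuousComponents {A : TwoTensor n X} (hA : C1Components A) :
    ContinuousComponents A := fun φ hφ i j => (hA φ hφ i j).continuousOn

theorem contDiffOn_comp_symm [IsManifold (𝓡 n) ∞ X]
    (hφ : φ ∈ atlas (EuclideanSpace ℝ (Fin n)) X) {η : X → ℝ}
    (hη : ContMDiff (𝓡 n) 𝓘(ℝ) ∞ η) : ContDiffOn ℝ ∞ (η ∘ φ.symm) φ.target :=
  contMDiffOn_iff_contDiffOn.1 (hη.comp_contMDiffOn
    (contMDiffOn_symm_of_mem_maximalAtlas (IsManifold.subset_maximalAtlas hφ)))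

theorem continuous_of_chart {F : X → ℝ}
    (hF : ∀ φ ∈ atlas (EuclideanSpace ℝ (Fin n)) X, ContinuousOn (F ∘ φ.symm) φ.target) :
    Continuous F := by
  refine continuous_iff_continuousAt.2 fun x => ?_
  set φ := chartAt (EuclideanSpace ℝ (Fin n)) x
  have hx : x ∈ φ.source := mem_chart_source _ x
  have h1 : ContinuousAt ((F ∘ φ.symm) ∘ φ) x :=
    ((hF φ (chart_mem_atlas _ x)).continuousAt
      (φ.open_target.mem_nhds (φ.map_source hx))).comp (φ.continuousAt hx)
  refine h1.congr ?_
  filter_upwards [φ.open_source.mem_nhds hx] with z hz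
  simp [φ.left_inv hz]

variable [IsManifold (𝓡 n) ∞ X]

/-- The pairing `⟨dη, df⟩` of two differentials with respect to the metric `g`. -/
def gradPair (g : TwoTensor n X) (η f : X → ℝ) (x : X) : ℝ :=
  let φ := chartAt (EuclideanSpace ℝ (Fin n)) x
  pairWith (comp φ g (φ x)) (fun a => pd a (η ∘ φ.symm) (φ x)) fun b => pd b (f ∘ φ.symm) (φ x)

variable {g : TwoTensor n X} {η f : X → ℝ}

/-- The pairing may be computed in any chart. -/
theorem gradPair_eq (hφ : φ ∈ atlas (EuclideanSpace ℝ (Fin n)) X)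
    (hη : ∀ φ ∈ atlas (EuclideanSpace ℝ (Fin n)) X, ContDiffOn ℝ 1 (η ∘ φ.symm) φ.target)
    (hf : ∀ φ ∈ atlas (EuclideanSpace ℝ (Fin n)) X, ContDiffOn ℝ 1 (f ∘ φ.symm) φ.target)
    {x : X} (hx : x ∈ φ.source) :
    gradPair g η f x = pairWith (comp φ g (φ x)) (fun a => pd a (η ∘ φ.symm) (φ x))
      fun b => pd b (f ∘ φ.symm) (φ x) :=
  pairWith_comp_eq (chart_mem_atlas _ x) hφ g (mem_chart_source _ x) hx
    (((hη φ hφ).contDiffAt (φ.open_target.mem_nhds (φ.map_source hx))).differentiableAt (by simp))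
    (((hf φ hφ).contDiffAt (φ.open_target.mem_nhds (φ.map_source hx))).differentiableAt (by simp))

variable {h : Metric n X}

theorem det_comp_metric_pos (h : Metric n X) (hφ : φ ∈ atlas (EuclideanSpace ℝ (Fin n)) X)
    {y : EuclideanSpace ℝ (Fin n)} (hy : y ∈ φ.target) : 0 < (comp φ h.inner y).det :=
  (posDef_comp_metric h hφ hy).det_pos

theorem continuous_gradPair (hg : C1Components h.inner)
    (hη : ∀ φ ∈ atlas (EuclideanSpace ℝ (Fin n)) X, ContDiffOn ℝ 1 (η ∘ φ.symm) φ.target)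
    (hf : ∀ φ ∈ atlas (EuclideanSpace ℝ (Fin n)) X, ContDiffOn ℝ 1 (f ∘ φ.symm) φ.target) :
    Continuous (gradPair h.inner η f) := by
  refine continuous_of_chart (n := n) fun φ hφ => ?_
  have h1 : ContinuousOn (fun y => pairWith (comp φ h.inner y) (fun a => pd a (η ∘ φ.symm) y)
      fun b => pd b (f ∘ φ.symm) y) φ.target := by
    refine continuousOn_finsetSum _ fun a _ => continuousOn_finsetSum _ fun b _ => ?_
    exact ((contDiffOn_inv_apply (hg φ hφ) (fun y hy =>
      (det_comp_metric_pos h hφ hy).ne'.isUnit) a b).continuousOn.mul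
      (contDiffOn_pd (k := 0) φ.open_target (hη φ hφ) (by simp) a).continuousOn).mul
      (contDiffOn_pd (k := 0) φ.open_target (hf φ hφ) (by simp) b).continuousOn
  refine h1.congr fun y hy => ?_
  rw [Function.comp_apply, gradPair_eq hφ hη hf (φ.map_target hy), φ.right_inv hy]

variable [CompactSpace X] [MeasurableSpace X] [BorelSpace X]

/-- Green's formula on `X`, for a test function `η` supported in the domain of a chart. -/
theorem integral_mul_laplacian_dvol (hg : C1Components h.inner)
    (hφ : φ ∈ atlas (EuclideanSpace ℝ (Fin n)) X)
    (hηc : Continuous η) (hsupp : tsupport η ⊆ φ.source)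
    (hη : ∀ φ ∈ atlas (EuclideanSpace ℝ (Fin n)) X, ContDiffOn ℝ 1 (η ∘ φ.symm) φ.target)
    (hf : ∀ φ ∈ atlas (EuclideanSpace ℝ (Fin n)) X, ContDiffOn ℝ 2 (f ∘ φ.symm) φ.target)
    {F : X → ℝ} (hFc : Continuous F)
    (hF : ∀ y ∈ φ.target, F (φ.symm y) = laplacian (comp φ h.inner) (f ∘ φ.symm) y) :
    ∫ x, η x * F x ∂(dvol h.inner) = -∫ x, gradPair h.inner η f x ∂(dvol h.inner) := by
  have hf1 : ∀ φ ∈ atlas (EuclideanSpace ℝ (Fin n)) X, ContDiffOn ℝ 1 (f ∘ φ.symm) φ.target :=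
    fun φ hφ => (hf φ hφ).of_le (by norm_num)
  have hgc := hg.continuousComponents
  have hη0 : ∀ x, x ∉ φ.source → η x = 0 := fun x hx =>
    image_eq_zero_of_notMem_tsupport fun h => hx (hsupp h)
  have hQ0 : ∀ x, x ∉ φ.source → gradPair h.inner η f x = 0 := fun x hx => by
    set ψ := chartAt (EuclideanSpace ℝ (Fin n)) x
    have hxψ : x ∈ ψ.source := mem_chart_source _ x
    have h0 : η =ᶠ[𝓝 (ψ.symm (ψ x))] fun _ => 0 := by
      rw [ψ.left_inv hxψ]
      exact notMem_tsupport_iff_eventuallyEq.1 fun h => hx (hsupp h)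
    have h1 : (η ∘ ψ.symm) =ᶠ[𝓝 (ψ x)] fun _ => 0 :=
      (ψ.continuousAt_symm (ψ.map_source hxψ)).eventually h0
    have h2 : ∀ a, pd a (η ∘ ψ.symm) (ψ x) = 0 := fun a => by
      rw [pd, h1.fderiv_eq]; simp
    have hψ : ψ ∈ atlas (EuclideanSpace ℝ (Fin n)) X := chart_mem_atlas _ x
    rw [gradPair_eq hψ hη hf1 hxψ]
    simp [pairWith, h2]
  rw [integral_dvol_eq hgc hφ (f := fun x => η x * F x) (hηc.mul hFc).measurable
      fun x hx => by rw [hη0 x hx, zero_mul],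
    integral_dvol_eq hgc hφ (continuous_gradPair hg hη hf1).measurable hQ0]
  set η' := φ.target.indicator (η ∘ φ.symm) with hη'
  have key := integral_mul_laplacian φ.open_target (hg φ hφ)
    (fun y hy => det_comp_metric_pos h hφ hy) (transpose_comp_metric h φ) (hf φ hφ)
    (contDiff_indicator hsupp (hη φ hφ)) (hasCompactSupport_indicator hsupp)
    (tsupport_indicator_subset_target hsupp)
  have hpd0 : ∀ y, y ∉ φ.target → ∀ a, pd a η' y = 0 := fun y hy a => by
    have h0 : η' =ᶠ[𝓝 y] fun _ => 0 :=
      notMem_tsupport_iff_eventuallyEq.1 fun h => hy (tsupport_indicator_subset_target hsupp h)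
    rw [pd, h0.fderiv_eq]; simp
  have e1 : ∫ y in φ.target, η' y * (√(comp φ h.inner y).det *
      laplacian (comp φ h.inner) (f ∘ φ.symm) y) = _ :=
    setIntegral_eq_integral_of_forall_compl_eq_zero fun y hy => by
      rw [hη', Set.indicator_of_notMem hy, zero_mul]
  have e2 : ∫ y in φ.target, √(comp φ h.inner y).det * pairWith (comp φ h.inner y)
      (fun a => pd a η' y) (fun b => pd b (f ∘ φ.symm) y) = _ :=
    setIntegral_eq_integral_of_forall_compl_eq_zero fun y hy => by
      simp [pairWith, hpd0 y hy]
  rw [← hη', ← e1, ← e2] at key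
  refine Eq.trans (setIntegral_congr_fun φ.open_target.measurableSet fun y hy => ?_)
    (key.trans (congrArg Neg.neg (setIntegral_congr_fun φ.open_target.measurableSet
      fun y hy => ?_)))
  · simp only [hη', Set.indicator_of_mem hy, hF y hy, volDensity, Function.comp_apply]
    ring
  · have h2 : ∀ a, pd a η' y = pd a (η ∘ φ.symm) y := fun a => by
      rw [pd, pd, (indicator_eventuallyEq hy).fderiv_eq]
    simp only [gradPair_eq hφ hη hf1 (φ.map_target hy), φ.right_inv hy, h2, volDensity]

/-- The divergence theorem on a closed manifold: the Laplacian of a function has integral zero.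
The Laplacian enters as a function `F` on `X` that is given by the coordinate formula in every
chart, so its independence of the chart is not needed. -/
theorem integral_laplacian_eq_zero [T2Space X] (hg : C1Components h.inner)
    (hf : ∀ φ ∈ atlas (EuclideanSpace ℝ (Fin n)) X, ContDiffOn ℝ 2 (f ∘ φ.symm) φ.target)
    {F : X → ℝ} (hFc : Continuous F)
    (hF : ∀ φ ∈ atlas (EuclideanSpace ℝ (Fin n)) X, ∀ y ∈ φ.target,
      F (φ.symm y) = laplacian (comp φ h.inner) (f ∘ φ.symm) y) :
    ∫ x, F x ∂(dvol h.inner) = 0 := by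
  have hf1 : ∀ φ ∈ atlas (EuclideanSpace ℝ (Fin n)) X, ContDiffOn ℝ 1 (f ∘ φ.symm) φ.target :=
    fun φ hφ => (hf φ hφ).of_le (by norm_num)
  have := isFiniteMeasure_dvol hg.continuousComponents
  obtain ⟨t, ht⟩ := CompactSpace.elim_nhds_subcover
    (fun x : X => (chartAt (EuclideanSpace ℝ (Fin n)) x).source) fun x => chart_source_mem_nhds _ x
  obtain ⟨ρ, hρ⟩ := SmoothPartitionOfUnity.exists_isSubordinate (𝓡 n) (isClosed_univ (X := X))
    (fun i : t => (chartAt (EuclideanSpace ℝ (Fin n)) (i : X)).source)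
    (fun i => (chartAt _ _).open_source) (by
      rw [← Set.top_eq_univ, ← ht]
      exact Set.iUnion₂_subset fun x hx => Set.subset_iUnion
        (fun i : t => (chartAt (EuclideanSpace ℝ (Fin n)) (i : X)).source) ⟨x, hx⟩)
  have hρ1 : ∀ x, ∑ i, ρ i x = 1 := fun x => by
    rw [← finsum_eq_sum_of_fintype]; exact ρ.sum_eq_one (Set.mem_univ x)
  have hρs : ∀ i, ∀ φ ∈ atlas (EuclideanSpace ℝ (Fin n)) X,
      ContDiffOn ℝ 1 (ρ i ∘ φ.symm) φ.target := fun i φ hφ =>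
    (contDiffOn_comp_symm hφ (ρ i).contMDiff).of_le (by simp)
  have hρc : ∀ i, Continuous (ρ i) := fun i => (ρ i).contMDiff.continuous
  have hint : ∀ {u : X → ℝ}, Continuous u → Integrable u (dvol h.inner) := fun hu =>
    hu.integrable_of_hasCompactSupport (HasCompactSupport.of_compactSpace _)
  -- The differentials of the partition functions sum to `d 1 = 0`.
  have hQ : ∀ x, ∑ i, gradPair h.inner (ρ i) f x = 0 := fun x => by
    set ψ := chartAt (EuclideanSpace ℝ (Fin n)) x
    have hψ : ψ ∈ atlas (EuclideanSpace ℝ (Fin n)) X := chart_mem_atlas _ x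
    have hxψ : x ∈ ψ.source := mem_chart_source _ x
    have h1 : ∀ a, ∑ i, pd a (ρ i ∘ ψ.symm) (ψ x) = 0 := fun a => by
      rw [← pd_sum (a := fun i => ρ i ∘ ψ.symm) fun i _ => ((hρs i ψ hψ).contDiffAt
        (ψ.open_target.mem_nhds (ψ.map_source hxψ))).differentiableAt (by simp)]
      have : (fun z => ∑ i, (ρ i ∘ ψ.symm) z) = fun _ => (1 : ℝ) := funext fun z => hρ1 _
      rw [this]; simp [pd]
    simp only [gradPair_eq hψ (hρs _) hf1 hxψ, pairWith]
    rw [Finset.sum_comm]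
    refine Finset.sum_eq_zero fun a _ => ?_
    rw [Finset.sum_comm]
    refine Finset.sum_eq_zero fun b _ => ?_
    rw [← Finset.sum_mul, ← Finset.mul_sum, h1 a]
    ring
  calc ∫ x, F x ∂(dvol h.inner) = ∫ x, ∑ i, ρ i x * F x ∂(dvol h.inner) := by
        simp only [← Finset.sum_mul, hρ1, one_mul]
    _ = ∑ i, ∫ x, ρ i x * F x ∂(dvol h.inner) :=
        integral_finsetSum _ fun i _ => hint ((hρc i).mul hFc)
    _ = ∑ i, -∫ x, gradPair h.inner (ρ i) f x ∂(dvol h.inner) :=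
        Finset.sum_congr rfl fun i _ => integral_mul_laplacian_dvol hg (chart_mem_atlas _ _)
          (hρc i) (hρ i) (hρs i) hf hFc (hF _ (chart_mem_atlas _ _))
    _ = -∫ x, ∑ i, gradPair h.inner (ρ i) f x ∂(dvol h.inner) := by
        rw [integral_finsetSum _ fun i _ => hint (continuous_gradPair hg (hρs i) hf1),
          Finset.sum_neg_distrib]
    _ = 0 := by simp only [hQ, integral_zero, neg_zero]

end Divergence

/-! ### Rescaling of the flow -/

section Rescaling

variable {n : ℕ}

theorem pd_const_mul (c : ℝ) (f : EuclideanSpace ℝ (Fin n) → ℝ) (i : Fin n)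
    (y : EuclideanSpace ℝ (Fin n)) : pd i (fun z => c * f z) y = c * pd i f y := by
  have : fderiv ℝ (c • f) y = (c • fderiv ℝ f) y := by rw [fderiv_const_smul_field]
  exact congrArg (fun T => T (EuclideanSpace.single i 1)) this

theorem christoffel_smul (g : EuclideanSpace ℝ (Fin n) → Matrix (Fin n) (Fin n) ℝ) {c : ℝ}
    (hc : c ≠ 0) (k i j : Fin n) : christoffel (fun y => c • g y) k i j = christoffel g k i j := by
  ext y
  simp only [christoffel, Matrix.smul_apply, smul_eq_mul, pd_const_mul, inv_smul_matrix _ hc]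
  congr 1
  refine Finset.sum_congr rfl fun l _ => ?_
  field_simp

/-- The Ricci tensor is invariant under scaling of the metric by a constant. -/
theorem ricci_smul (g : EuclideanSpace ℝ (Fin n) → Matrix (Fin n) (Fin n) ℝ) {c : ℝ}
    (hc : c ≠ 0) : ricci (fun y => c • g y) = ricci g := by
  ext y i j
  simp only [ricci, christoffel_smul g hc]

variable {X : Type*} [TopologicalSpace X] [ChartedSpace (EuclideanSpace ℝ (Fin n)) X]

theorem scalarCurvature_rescaledMetric [IsManifold (𝓡 n) ∞ X] (h : ℝ → Metric n X) {s : ℝ}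
    (hs : s ≠ 0) (u : ℝ) (x : X) :
    scalarCurvature (rescaledMetric h s u) x =
      s ^ 2 * scalarCurvature (h (s * u)).inner x := by
  have hc : (s ^ 2)⁻¹ ≠ 0 := inv_ne_zero (pow_ne_zero 2 hs)
  have h1 : comp (chartAt (EuclideanSpace ℝ (Fin n)) x) (rescaledMetric h s u) = fun y =>
      (s ^ 2)⁻¹ • comp (chartAt (EuclideanSpace ℝ (Fin n)) x) (h (s * u)).inner y := rfl
  simp only [scalarCurvature, h1, ricci_smul _ hc, traceWith_smul_left _ _ hc, inv_inv]

theorem normSq_rescaled [IsManifold (𝓡 n) ∞ X] (h : ℝ → Metric n X)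
    (K : ℝ → TwoTensor n X) {s : ℝ}
    (hs : s ≠ 0) (u : ℝ) (x : X) :
    normSq (rescaledMetric h s u) (rescaledK K s u) x =
      s ^ 2 * normSq (h (s * u)).inner (K (s * u)) x := by
  have hc : (s ^ 2)⁻¹ ≠ 0 := inv_ne_zero (pow_ne_zero 2 hs)
  have h1 : comp (chartAt (EuclideanSpace ℝ (Fin n)) x) (rescaledMetric h s u) = fun y =>
      (s ^ 2)⁻¹ • comp (chartAt (EuclideanSpace ℝ (Fin n)) x) (h (s * u)).inner y := rfl
  have h2 : comp (chartAt (EuclideanSpace ℝ (Fin n)) x) (rescaledK K s u) = fun y =>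
      s⁻¹ • comp (chartAt (EuclideanSpace ℝ (Fin n)) x) (K (s * u)) y := rfl
  simp only [normSq, h1, h2, normSqWith_smul_smul _ _ hc, inv_inv]
  congr 1
  field_simp

end Rescaling

/-! ### The lapse equation and the evolution of the volume -/

section Flow

theorem continuous_slice {X : Type*} [TopologicalSpace X] {F : ℝ → X → ℝ} {I : Set ℝ} {t : ℝ}
    (hF : ContinuousOn (fun p : ℝ × X => F p.1 p.2) (I ×ˢ Set.univ)) (ht : t ∈ I) :
    Continuous (F t) :=
  hF.comp_continuous (f := fun x => (t, x)) (by fun_prop) fun x => ⟨ht, Set.mem_univ x⟩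

theorem two_le_infty : (2 : WithTop ℕ∞) ≤ ((⊤ : ℕ∞) : WithTop ℕ∞) :=
  show ((2 : ℕ∞) : WithTop ℕ∞) ≤ ((⊤ : ℕ∞) : WithTop ℕ∞) from WithTop.coe_le_coe.2 le_top

variable {n : ℕ} {X : Type*} [TopologicalSpace X] [ChartedSpace (EuclideanSpace ℝ (Fin n)) X]
  {φ : OpenPartialHomeomorph X (EuclideanSpace ℝ (Fin n))} {I : Set ℝ}

theorem continuousOn_of_charts {F : ℝ → X → ℝ}
    (hF : ∀ φ ∈ atlas (EuclideanSpace ℝ (Fin n)) X,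
      ContinuousOn (fun p : ℝ × EuclideanSpace ℝ (Fin n) => F p.1 (φ.symm p.2)) (I ×ˢ φ.target)) :
    ContinuousOn (fun p : ℝ × X => F p.1 p.2) (I ×ˢ Set.univ) := by
  rintro ⟨t, x⟩ ⟨ht, -⟩
  set φ := chartAt (EuclideanSpace ℝ (Fin n)) x
  have hx : x ∈ φ.source := mem_chart_source _ x
  have h1 : ContinuousOn (fun p : ℝ × X => F p.1 (φ.symm (φ p.2))) (I ×ˢ φ.source) :=
    (hF φ (chart_mem_atlas _ x)).comp
      (continuousOn_fst.prodMk (φ.continuousOn.comp continuousOn_snd fun p hp => hp.2))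
      fun p hp => ⟨hp.1, φ.map_source hp.2⟩
  have h2 : ContinuousOn (fun p : ℝ × X => F p.1 p.2) (I ×ˢ φ.source) :=
    h1.congr fun p hp => by simp only [φ.left_inv hp.2]
  refine (h2 (t, x) ⟨ht, hx⟩).mono_of_mem_nhdsWithin ?_
  have h3 : (Set.univ ×ˢ φ.source : Set (ℝ × X)) ∈ 𝓝 (t, x) :=
    prod_mem_nhds Filter.univ_mem (φ.open_source.mem_nhds hx)
  filter_upwards [self_mem_nhdsWithin, mem_nhdsWithin_of_mem_nhds h3] with p hp1 hp2
  exact ⟨hp1.1, hp2.2⟩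

variable [IsManifold (𝓡 n) ∞ X] {L : ℝ → X → ℝ} {h : ℝ → Metric n X} {K : ℝ → TwoTensor n X}
  {t : ℝ}

theorem IsEinsteinFlow.contDiffOn_metric (hflow : IsEinsteinFlow I L h K) (ht : t ∈ I)
    (hφ : φ ∈ atlas (EuclideanSpace ℝ (Fin n)) X) (i j : Fin n) :
    ContDiffOn ℝ ∞ (fun y => comp φ (h t).inner y i j) φ.target :=
  (hflow.smooth_metric φ hφ i j).comp (f := fun y => (t, y))
    (contDiffOn_const.prodMk contDiffOn_id) fun _ hy => ⟨ht, hy⟩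

theorem IsEinsteinFlow.contDiffOn_lapse (hflow : IsEinsteinFlow I L h K) (ht : t ∈ I)
    (hφ : φ ∈ atlas (EuclideanSpace ℝ (Fin n)) X) : ContDiffOn ℝ ∞ (L t ∘ φ.symm) φ.target :=
  (hflow.smooth_lapse φ hφ).comp (f := fun y => (t, y))
    (contDiffOn_const.prodMk contDiffOn_id) fun _ hy => ⟨ht, hy⟩

theorem IsEinsteinFlow.c1Components (hflow : IsEinsteinFlow I L h K) (ht : t ∈ I) :
    C1Components (h t).inner := fun _ hφ i j =>
  (hflow.contDiffOn_metric ht hφ i j).of_le (by simp)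

theorem normSq_eq (hφ : φ ∈ atlas (EuclideanSpace ℝ (Fin n)) X) (g A : TwoTensor n X) {x : X}
    (hx : x ∈ φ.source) : normSq g A x = normSqWith (comp φ g (φ x)) (comp φ A (φ x)) :=
  normSqWith_comp_eq (chart_mem_atlas _ x) hφ g A (mem_chart_source _ x) hx

theorem normSq_symm_eq (hφ : φ ∈ atlas (EuclideanSpace ℝ (Fin n)) X) (g A : TwoTensor n X)
    {y : EuclideanSpace ℝ (Fin n)} (hy : y ∈ φ.target) :
    normSq g A (φ.symm y) = normSqWith (comp φ g y) (comp φ A y) := by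
  rw [normSq_eq hφ g A (φ.map_target hy), φ.right_inv hy]

theorem IsEinsteinFlow.continuousOn_lapse (hflow : IsEinsteinFlow I L h K) :
    ContinuousOn (fun p : ℝ × X => L p.1 p.2) (I ×ˢ Set.univ) :=
  continuousOn_of_charts (n := n) fun φ hφ => (hflow.smooth_lapse φ hφ).continuousOn

theorem IsEinsteinFlow.continuousOn_normSq (hflow : IsEinsteinFlow I L h K) :
    ContinuousOn (fun p : ℝ × X => normSq (h p.1).inner (K p.1) p.2) (I ×ˢ Set.univ) := by
  refine continuousOn_of_charts (n := n) (F := fun t x => normSq (h t).inner (K t) x) fun φ hφ => ?_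
  have hm : ContinuousOn (fun p : ℝ × EuclideanSpace ℝ (Fin n) =>
      (fun i j => comp φ (h p.1).inner p.2 i j : Fin n → Fin n → ℝ)) (I ×ˢ φ.target) :=
    continuousOn_pi.2 fun i => continuousOn_pi.2 fun j =>
      (hflow.smooth_metric φ hφ i j).continuousOn
  have hinv : ∀ a b, ContinuousOn (fun p : ℝ × EuclideanSpace ℝ (Fin n) =>
      (comp φ (h p.1).inner p.2)⁻¹ a b) (I ×ˢ φ.target) := fun a b p hp =>
    ContinuousAt.comp_continuousWithinAt (g := fun N : Fin n → Fin n → ℝ => (Matrix.of N)⁻¹ a b)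
      (contDiffAt_inv_apply (k := 0) (M := fun i j => comp φ (h p.1).inner p.2 i j)
        (det_comp_metric_pos (h p.1) hφ hp.2).ne'.isUnit a b).continuousAt (hm p hp)
  have hK : ∀ a b, ContinuousOn (fun p : ℝ × EuclideanSpace ℝ (Fin n) =>
      comp φ (K p.1) p.2 a b) (I ×ˢ φ.target) := fun a b =>
    (hflow.smooth_secondFundamentalForm φ hφ a b).continuousOn
  have h1 : ContinuousOn (fun p : ℝ × EuclideanSpace ℝ (Fin n) =>
      normSqWith (comp φ (h p.1).inner p.2) (comp φ (K p.1) p.2)) (I ×ˢ φ.target) :=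
    continuousOn_finsetSum _ fun i _ => continuousOn_finsetSum _ fun j _ =>
      continuousOn_finsetSum _ fun k _ => continuousOn_finsetSum _ fun l _ =>
        (((hinv i k).mul (hinv j l)).mul (hK i j)).mul (hK k l)
  exact h1.congr fun p hp => normSq_symm_eq hφ _ _ hp.2

variable {t₀ : ℝ}

theorem IsHubbleCMCFlow.traceWith_eq (hflow : IsHubbleCMCFlow I L h K) (ht : t ∈ I)
    (hφ : φ ∈ atlas (EuclideanSpace ℝ (Fin n)) X) {y : EuclideanSpace ℝ (Fin n)}
    (hy : y ∈ φ.target) :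
    traceWith (comp φ (h t).inner y) (comp φ (K t) y) = -(n / t) := by
  rw [← hflow.meanCurvature_eq t ht (φ.symm y), trace,
    traceWith_comp_eq (chart_mem_atlas _ _) hφ _ _ (mem_chart_source _ _) (φ.map_target hy),
    φ.right_inv hy]

theorem IsHubbleCMCFlow.traceWith_ricci_eq (hn : 1 ≤ n) (hflow : IsHubbleCMCFlow I L h K)
    (ht : t ∈ I) (hφ : φ ∈ atlas (EuclideanSpace ℝ (Fin n)) X) {y : EuclideanSpace ℝ (Fin n)}
    (hy : y ∈ φ.target) :
    traceWith (comp φ (h t).inner y) (ricci (comp φ (h t).inner) y) =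
      normSqWith (comp φ (h t).inner y) (comp φ (K t) y) - (n / t) ^ 2 := by
  have hn' : (n : ℝ) ≠ 0 := by positivity
  have h1 := hflow.hamiltonian_constraint φ hφ t ht y hy
  simp only [hflow.traceWith_eq ht hφ hy] at h1
  rw [normSqWith_sub_smul (transpose_comp_metric _ φ y) (det_comp_metric_pos _ hφ hy).ne'.isUnit,
    hflow.traceWith_eq ht hφ hy] at h1
  generalize (n : ℝ) / t = q at *
  have h2 : ∀ a b : ℝ, a - (b - 2 * (-q / n) * -q + (-q / n) ^ 2 * n) + (1 - 1 / n) * (-q) ^ 2 =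
      a - b + q ^ 2 := fun a b => by field_simp; ring
  rw [h2] at h1
  linarith

/-- With `H = -n/t`, the Hamiltonian constraint says `R = |K|² - n²/t²`. -/
theorem IsHubbleCMCFlow.scalarCurvature_eq (hn : 1 ≤ n) (hflow : IsHubbleCMCFlow I L h K)
    (ht : t ∈ I) (x : X) :
    scalarCurvature (h t).inner x = normSq (h t).inner (K t) x - (n / t) ^ 2 :=
  hflow.traceWith_ricci_eq hn ht (chart_mem_atlas _ x) (mem_chart_target _ x)

/-- The lapse equation `-ΔL + L |K|² = n / t²`, which is the trace of the evolution equation of `K`,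
simplified by means of the Hamiltonian constraint. -/
theorem IsHubbleCMCFlow.lapse_equation (hn : 1 ≤ n)
    (hflow : IsHubbleCMCFlow (Set.Ioc 0 t₀) L h K) (ht : t ∈ Set.Ioc 0 t₀)
    (hφ : φ ∈ atlas (EuclideanSpace ℝ (Fin n)) X) {y : EuclideanSpace ℝ (Fin n)}
    (hy : y ∈ φ.target) :
    laplacian (comp φ (h t).inner) (L t ∘ φ.symm) y =
      L t (φ.symm y) * normSq (h t).inner (K t) (φ.symm y) - n / t ^ 2 := by
  rw [normSq_symm_eq hφ _ _ hy]
  have hgd := hasDerivWithinAt_inv_apply (G := fun τ => comp φ (h τ).inner y)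
    (G' := Matrix.of fun i j => -2 * L t (φ.symm y) * comp φ (K t) y i j)
    (hflow.evolution_metric φ hφ t ht y hy) (det_comp_metric_pos _ hφ hy).ne'.isUnit
  have hkd := hflow.evolution_secondFundamentalForm φ hφ t ht y hy
  have hR := hflow.traceWith_ricci_eq hn ht hφ hy
  have hH := hflow.traceWith_eq ht hφ hy
  have htd : HasDerivWithinAt (fun τ => traceWith (comp φ (h τ).inner y) (comp φ (K τ) y)) _
      (Set.Ioc 0 t₀) t :=
    HasDerivWithinAt.fun_sum fun i _ => HasDerivWithinAt.fun_sum fun j _ => (hgd i j).mul (hkd i j)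
  have ht0 : t ≠ 0 := ht.1.ne'
  have hcd : HasDerivWithinAt (fun τ => traceWith (comp φ (h τ).inner y) (comp φ (K τ) y))
      (n / t ^ 2) (Set.Ioc 0 t₀) t := by
    have h1 : HasDerivAt (fun τ : ℝ => -((n : ℝ) / τ)) (n / t ^ 2) t := by
      simp only [div_eq_mul_inv]
      exact ((hasDerivAt_inv ht0).const_mul (n : ℝ)).fun_neg.congr_deriv (by ring)
    exact h1.hasDerivWithinAt.congr (fun τ hτ => hflow.traceWith_eq hτ hφ hy) hH
  have hud : UniqueDiffWithinAt ℝ (Set.Ioc 0 t₀) t :=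
    uniqueDiffOn_Ioc 0 t₀ t ht
  -- The trace `H = -n/t` differentiated in two ways.
  have heq := hud.eq_deriv _ htd hcd
  have hksymm : ∀ a b, comp φ (K t) y a b = comp φ (K t) y b a := fun a b => hflow.symm t ht _ _ _
  have hgsymm := transpose_comp_metric (h t) φ y
  have hHh : laplacian (comp φ (h t).inner) (L t ∘ φ.symm) y =
    ∑ i, ∑ j, (comp φ (h t).inner y)⁻¹ i j *
      hessian (comp φ (h t).inner) (fun z => L t (φ.symm z)) i j y := rfl
  rw [hHh]
  simp only [hH] at heq
  simp only [traceWith] at hR hH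
  rw [normSqWith] at hR ⊢
  generalize comp φ (h t).inner = g at *
  generalize comp φ (K t) y = k at *
  generalize L t (φ.symm y) = ℓ at *
  generalize hessian g (fun z => L t (φ.symm z)) = hess at *
  generalize ricci g y = ric at *
  have hγ : ∀ a b, (g y)⁻¹ a b = (g y)⁻¹ b a := fun a b => by
    have hgi : (g y)⁻¹.transpose = (g y)⁻¹ := by rw [Matrix.transpose_nonsing_inv, hgsymm]
    exact congrFun (congrFun hgi b) a
  generalize (g y)⁻¹ = γ at *
  have e1 : ∑ i, ∑ j, (-∑ a, ∑ b, γ i a * γ b j *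
      (Matrix.of fun i j => -2 * ℓ * k i j) a b) * k i j =
      2 * ℓ * ∑ i, ∑ j, ∑ a, ∑ b, γ i a * γ j b * k i j * k a b := by
    simp only [Finset.mul_sum, ← Finset.sum_neg_distrib, Finset.sum_mul, Matrix.of_apply]
    exact Finset.sum_congr rfl fun i _ => Finset.sum_congr rfl fun j _ => Finset.sum_congr rfl
      fun a _ => Finset.sum_congr rfl fun b _ => by rw [hγ b j]; ring
  have e2 : ∑ i, ∑ j, γ i j * ∑ a, ∑ b, γ a b * k i a * k b j =
      ∑ i, ∑ j, ∑ a, ∑ b, γ i a * γ j b * k i j * k a b := by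
    simp only [Finset.mul_sum]
    refine Finset.sum_congr rfl fun i _ => ?_
    rw [Finset.sum_comm]
    exact Finset.sum_congr rfl fun j _ => Finset.sum_congr rfl
      fun a _ => Finset.sum_congr rfl fun b _ => by rw [hksymm b a]; ring
  have e3 : ∀ c : Fin n → Fin n → ℝ, ∑ i, ∑ j, γ i j * (ℓ * -(n / t) * k i j - 2 * ℓ * c i j
        - hess i j y + ℓ * ric i j) =
      ℓ * -(n / t) * ∑ i, ∑ j, γ i j * k i j - 2 * ℓ * ∑ i, ∑ j, γ i j * c i j -
        ∑ i, ∑ j, γ i j * hess i j y + ℓ * ∑ i, ∑ j, γ i j * ric i j := fun c => by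
    simp only [Finset.mul_sum, ← Finset.sum_add_distrib, ← Finset.sum_sub_distrib]
    exact Finset.sum_congr rfl fun i _ => Finset.sum_congr rfl fun j _ => by ring
  simp only [Finset.sum_add_distrib] at heq
  rw [e1, e3, e2, hR, hH] at heq
  linear_combination -heq

/-- The minimum principle for the lapse equation: nonpositive scalar curvature forces `L ≥ 1/n`. -/
theorem IsHubbleCMCFlow.lapse_ge (hn : 1 ≤ n) [CompactSpace X]
    (hflow : IsHubbleCMCFlow (Set.Ioc 0 t₀) L h K) (ht : t ∈ Set.Ioc 0 t₀)
    (hR : ∀ x, scalarCurvature (h t).inner x ≤ 0) (x : X) : 1 / (n : ℝ) ≤ L t x := by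
  have hLc : Continuous (L t) := continuous_of_chart (n := n) fun φ hφ =>
    (hflow.contDiffOn_lapse ht hφ).continuousOn
  obtain ⟨z, -, hz⟩ := isCompact_univ.exists_isMinOn ⟨x, Set.mem_univ x⟩ hLc.continuousOn
  refine le_trans ?_ (hz (Set.mem_univ x))
  set φ := chartAt (EuclideanSpace ℝ (Fin n)) z
  have hφ : φ ∈ atlas (EuclideanSpace ℝ (Fin n)) X := chart_mem_atlas _ z
  have hzφ : z ∈ φ.source := mem_chart_source _ z
  have hy := φ.map_source hzφ
  have h1 := laplacian_nonneg_of_isLocalMin (posDef_comp_metric (h t) hφ hy)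
    (((hflow.contDiffOn_lapse ht hφ).contDiffAt (φ.open_target.mem_nhds hy)).of_le two_le_infty)
    (Filter.Eventually.of_forall fun w => by
      simp only [Function.comp_apply, φ.left_inv hzφ]
      exact hz (Set.mem_univ _))
  rw [hflow.lapse_equation hn ht hφ hy, φ.left_inv hzφ] at h1
  have h2 := hR z
  rw [hflow.scalarCurvature_eq hn ht z] at h2
  have h3 := hflow.lapse_nonneg t ht z
  have hn' : (0 : ℝ) < n := by positivity
  have ht0 : 0 < t := ht.1
  have h4 : (n : ℝ) / t ^ 2 ≤ L t z * (n / t) ^ 2 := by nlinarith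
  rw [div_pow, ← mul_div_assoc, div_le_div_iff_of_pos_right (by positivity)] at h4
  rw [div_le_iff₀ hn']
  nlinarith

/-- The lapse equation, integrated over the closed manifold `X`. -/
theorem IsHubbleCMCFlow.integral_lapse_equation (hn : 1 ≤ n) [CompactSpace X] [T2Space X]
    [MeasurableSpace X] [BorelSpace X]
    (hflow : IsHubbleCMCFlow (Set.Ioc 0 t₀) L h K) (ht : t ∈ Set.Ioc 0 t₀) :
    ∫ x, (L t x * normSq (h t).inner (K t) x - n / t ^ 2) ∂(dvol (h t).inner) = 0 := by
  have hLc : Continuous (L t) := continuous_slice hflow.continuousOn_lapse ht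
  have hNc : Continuous fun x => normSq (h t).inner (K t) x :=
    continuous_slice (F := fun t x => normSq (h t).inner (K t) x) hflow.continuousOn_normSq ht
  exact integral_laplacian_eq_zero (f := L t) (hflow.c1Components ht)
    (fun φ hφ => (hflow.contDiffOn_lapse ht hφ).of_le two_le_infty)
    ((hLc.mul hNc).sub continuous_const)
    fun φ hφ y hy => (hflow.lapse_equation hn ht hφ hy).symm

/-- The ratio of the volume densities at the times `t` and `t₀`. It does not depend on the chart, so
it is a function on `X`. -/
def volRatio (h : ℝ → Metric n X) (t₀ t : ℝ) (x : X) : ℝ :=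
  let φ := chartAt (EuclideanSpace ℝ (Fin n)) x
  volDensity φ (h t).inner (φ x) / volDensity φ (h t₀).inner (φ x)

theorem volDensity_pos (h : Metric n X) (hφ : φ ∈ atlas (EuclideanSpace ℝ (Fin n)) X)
    {y : EuclideanSpace ℝ (Fin n)} (hy : y ∈ φ.target) : 0 < volDensity φ h.inner y :=
  Real.sqrt_pos.2 (det_comp_metric_pos h hφ hy)

theorem volRatio_eq (h : ℝ → Metric n X) (t₀ t : ℝ)
    (hφ : φ ∈ atlas (EuclideanSpace ℝ (Fin n)) X) {x : X} (hx : x ∈ φ.source) :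
    volRatio h t₀ t x =
      volDensity φ (h t).inner (φ x) / volDensity φ (h t₀).inner (φ x) := by
  set ψ := chartAt (EuclideanSpace ℝ (Fin n)) x with hψdef
  have hψ : ψ ∈ atlas (EuclideanSpace ℝ (Fin n)) X := chart_mem_atlas _ x
  have hxψ : x ∈ ψ.source := mem_chart_source _ x
  have hy := ψ.map_source hxψ
  have hyφ : ψ.symm (ψ x) ∈ φ.source := by rwa [ψ.left_inv hxψ]
  have hJ := isUnit_det_jac hψ hφ hy hyφ
  rw [det_jac] at hJ
  rw [volRatio, ← hψdef]
  simp only [volDensity_eq hψ hφ _ hy hyφ, ψ.left_inv hxψ]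
  exact mul_div_mul_left _ _ (abs_pos.2 hJ.ne_zero).ne'

theorem volRatio_pos (h : ℝ → Metric n X) (t₀ t : ℝ) (x : X) : 0 < volRatio h t₀ t x :=
  div_pos (volDensity_pos _ (chart_mem_atlas _ x) (mem_chart_target _ x))
    (volDensity_pos _ (chart_mem_atlas _ x) (mem_chart_target _ x))

theorem IsEinsteinFlow.continuousOn_volRatio
    (hflow : IsEinsteinFlow I L h K) (ht₀ : t₀ ∈ I) :
    ContinuousOn (fun p : ℝ × X => volRatio h t₀ p.1 p.2) (I ×ˢ Set.univ) := by
  refine continuousOn_of_charts (n := n) (F := volRatio h t₀) fun φ hφ => ?_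
  have hm : ContinuousOn (fun p : ℝ × EuclideanSpace ℝ (Fin n) =>
      (fun i j => comp φ (h p.1).inner p.2 i j : Fin n → Fin n → ℝ)) (I ×ˢ φ.target) :=
    continuousOn_pi.2 fun i => continuousOn_pi.2 fun j =>
      (hflow.smooth_metric φ hφ i j).continuousOn
  have h1 : ContinuousOn (fun p : ℝ × EuclideanSpace ℝ (Fin n) =>
      volDensity φ (h p.1).inner p.2) (I ×ˢ φ.target) :=
    ((contDiff_det (k := 0)).continuous.comp_continuousOn hm).sqrt
  have h2 : ContinuousOn (fun p : ℝ × EuclideanSpace ℝ (Fin n) =>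
      volDensity φ (h t₀).inner p.2) (I ×ˢ φ.target) :=
    ((hflow.c1Components ht₀).continuousComponents.continuousOn_volDensity hφ).comp
      continuousOn_snd fun p hp => hp.2
  refine (h1.div h2 fun p hp => (volDensity_pos _ hφ hp.2).ne').congr fun p hp => ?_
  simp only [Pi.div_apply, volRatio_eq h t₀ p.1 hφ (φ.map_target hp.2), φ.right_inv hp.2]

/-- The evolution of the volume form, `∂_t dvol = - L H dvol = (n / t) L dvol`. -/
theorem IsHubbleCMCFlow.hasDerivWithinAt_volRatio (hflow : IsHubbleCMCFlow I L h K) (ht : t ∈ I)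
    (x : X) : HasDerivWithinAt (fun τ => volRatio h t₀ τ x)
      (n / t * L t x * volRatio h t₀ t x) I t := by
  set φ := chartAt (EuclideanSpace ℝ (Fin n)) x with hφdef
  have hφ : φ ∈ atlas (EuclideanSpace ℝ (Fin n)) X := chart_mem_atlas _ x
  have hx : x ∈ φ.source := mem_chart_source _ x
  have hy := φ.map_source hx
  have h1 := hasDerivWithinAt_sqrt_det (G := fun τ => comp φ (h τ).inner (φ x))
    (G' := (-2 * L t (φ.symm (φ x))) • comp φ (K t) (φ x))
    (hflow.evolution_metric φ hφ t ht (φ x) hy) (det_comp_metric_pos _ hφ hy)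
    (transpose_comp_metric _ _ _)
  refine (h1.div_const (volDensity φ (h t₀).inner (φ x))).congr_deriv ?_
  have h2 : traceWith (comp φ (h t).inner (φ x))
      ((-2 * L t (φ.symm (φ x))) • comp φ (K t) (φ x)) = 2 * L t x * (n / t) := by
    have h3 := hflow.traceWith_eq ht hφ hy
    have h4 : ∀ (g A : Matrix (Fin n) (Fin n) ℝ) (c : ℝ),
        traceWith g (c • A) = c * traceWith g A := fun g A c => by
      simp [traceWith, Finset.mul_sum, mul_left_comm]
    rw [h4, h3, φ.left_inv hx]
    ring
  rw [h2, volRatio, ← hφdef]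
  simp only [volDensity]
  ring

theorem IsEinsteinFlow.dvol_eq_withDensity_volRatio [CompactSpace X] [MeasurableSpace X]
    [BorelSpace X] (hflow : IsEinsteinFlow I L h K) (ht₀ : t₀ ∈ I) (ht : t ∈ I) :
    dvol (h t).inner =
      (dvol (h t₀).inner).withDensity fun x => ENNReal.ofReal (volRatio h t₀ t x) := by
  have hc : Continuous (volRatio h t₀ t) :=
    continuous_slice (hflow.continuousOn_volRatio ht₀) ht
  refine dvol_eq_withDensity (n := n) (hflow.c1Components ht₀).continuousComponents
    (hflow.c1Components ht).continuousComponents hc.measurable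
    (fun x => (volRatio_pos h t₀ t x).le) fun φ hφ x hx => ?_
  rw [volRatio_eq h t₀ t hφ hx, div_mul_cancel₀ _ (volDensity_pos _ hφ (φ.map_source hx)).ne']

end Flow

/-! ### Monotone families of densities -/

section MonotoneDensity

open Set Filter

variable {X : Type*} [TopologicalSpace X]

/-- A family of nonnegative functions `κ t`, `0 < t ≤ t₀`, that is nondecreasing in `t` with time
derivative `∂κ/∂t = w / t`, where `κ` and `w ≥ 0` are jointly continuous. -/
structure IsMonotoneDensity (t₀ : ℝ) (κ w : ℝ → X → ℝ) : Prop where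
  pos : 0 < t₀
  nonneg : ∀ t ∈ Ioc 0 t₀, ∀ x, 0 ≤ κ t x
  deriv_nonneg : ∀ t ∈ Ioc 0 t₀, ∀ x, 0 ≤ w t x
  hasDerivWithinAt : ∀ t ∈ Ioc 0 t₀, ∀ x,
    HasDerivWithinAt (fun τ => κ τ x) (w t x / t) (Ioc 0 t₀) t
  continuousOn : ContinuousOn (fun p : ℝ × X => κ p.1 p.2) (Ioc 0 t₀ ×ˢ univ)
  continuousOn_deriv : ContinuousOn (fun p : ℝ × X => w p.1 p.2) (Ioc 0 t₀ ×ˢ univ)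

/-- The limit of `κ t x` as `t → 0`, encoded as an infimum. The time is truncated at `t₀`
because nothing is known about `κ` at later times. -/
def limitDensity (t₀ : ℝ) (κ : ℝ → X → ℝ) (x : X) : ℝ :=
  sInf ((fun t => κ (min t t₀) x) '' Ioi 0)

variable {t₀ t s Λ : ℝ} {κ w : ℝ → X → ℝ}

namespace IsMonotoneDensity

theorem monotoneOn (hκ : IsMonotoneDensity t₀ κ w) (x : X) :
    MonotoneOn (fun t => κ t x) (Ioc 0 t₀) := by
  have hint : ∀ t ∈ interior (Ioc 0 t₀), HasDerivAt (fun τ => κ τ x) (w t x / t) t := fun t ht => by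
    rw [interior_Ioc] at ht
    exact (hκ.hasDerivWithinAt t (Ioo_subset_Ioc_self ht) x).hasDerivAt
      (Filter.mem_of_superset (isOpen_Ioo.mem_nhds ht) Ioo_subset_Ioc_self)
  refine monotoneOn_of_deriv_nonneg (convex_Ioc 0 t₀)
    (fun t ht => (hκ.hasDerivWithinAt t ht x).continuousWithinAt)
    (fun t ht => (hint t ht).differentiableAt.differentiableWithinAt) fun t ht => ?_
  have ht' := interior_subset ht
  rw [(hint t ht).deriv]
  exact div_nonneg (hκ.deriv_nonneg t ht' x) ht'.1.le

theorem tendsto_limitDensity (hκ : IsMonotoneDensity t₀ κ w) (x : X) :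
    Tendsto (fun t => κ t x) (𝓝[>] 0) (𝓝 (limitDensity t₀ κ x)) := by
  have hmem : ∀ t ∈ Ioi (0 : ℝ), min t t₀ ∈ Ioc 0 t₀ := fun t ht =>
    ⟨lt_min ht hκ.pos, min_le_right _ _⟩
  have h1 : MonotoneOn (fun t => κ (min t t₀) x) (Ioi 0) := fun a ha b hb hab =>
    hκ.monotoneOn x (hmem a ha) (hmem b hb) (min_le_min_right _ hab)
  have h2 : BddBelow ((fun t => κ (min t t₀) x) '' Ioi 0) :=
    ⟨0, by rintro _ ⟨t, ht, rfl⟩; exact hκ.nonneg _ (hmem t ht) x⟩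
  refine (h1.tendsto_nhdsGT h2).congr' ?_
  filter_upwards [Ioc_mem_nhdsGT hκ.pos] with t ht
  rw [min_eq_left ht.2]

theorem limitDensity_le (hκ : IsMonotoneDensity t₀ κ w) (ht : t ∈ Ioc 0 t₀) (x : X) :
    limitDensity t₀ κ x ≤ κ t x := by
  refine le_of_tendsto (hκ.tendsto_limitDensity x) ?_
  filter_upwards [Ioc_mem_nhdsGT ht.1] with τ hτ
  exact hκ.monotoneOn x ⟨hτ.1, hτ.2.trans ht.2⟩ ht hτ.2

theorem continuous (hκ : IsMonotoneDensity t₀ κ w) (ht : t ∈ Ioc 0 t₀) : Continuous (κ t) :=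
  continuous_slice hκ.continuousOn ht

theorem mul_mem_Ioo (hΛ : 1 < Λ) (hs : 0 < s) (hsΛ : s * Λ < t₀) {u : ℝ} (hu : u ∈ Icc Λ⁻¹ Λ) :
    s * u ∈ Ioo 0 t₀ := by
  have hu0 : 0 < u := lt_of_lt_of_le (by positivity) hu.1
  exact ⟨mul_pos hs hu0, (mul_le_mul_of_nonneg_left hu.2 hs.le).trans_lt hsΛ⟩

theorem continuousOn_rescale {F : ℝ → X → ℝ}
    (hF : ContinuousOn (fun p : ℝ × X => F p.1 p.2) (Ioc 0 t₀ ×ˢ univ)) (hΛ : 1 < Λ) (hs : 0 < s)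
    (hsΛ : s * Λ < t₀) :
    ContinuousOn (fun p : ℝ × X => F (s * p.1) p.2) (Icc Λ⁻¹ Λ ×ˢ univ) :=
  hF.comp (f := fun p : ℝ × X => (s * p.1, p.2)) (by fun_prop)
    fun _ hp => ⟨Ioo_subset_Ioc_self (mul_mem_Ioo hΛ hs hsΛ hp.1), mem_univ _⟩

theorem continuousOn_deriv_div (hκ : IsMonotoneDensity t₀ κ w) (hΛ : 1 < Λ) (hs : 0 < s)
    (hsΛ : s * Λ < t₀) :
    ContinuousOn (fun p : ℝ × X => w (s * p.1) p.2 / p.1) (Icc Λ⁻¹ Λ ×ˢ univ) :=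
  (continuousOn_rescale hκ.continuousOn_deriv hΛ hs hsΛ).div continuousOn_fst fun p hp =>
    (lt_of_lt_of_le (by positivity : 0 < Λ⁻¹) hp.1.1).ne'

/-- The fundamental theorem of calculus in the rescaled time `u`. -/
theorem lintegral_time (hκ : IsMonotoneDensity t₀ κ w) (hΛ : 1 < Λ) (hs : 0 < s)
    (hsΛ : s * Λ < t₀) (x : X) :
    ∫⁻ u in Icc Λ⁻¹ Λ, ENNReal.ofReal (w (s * u) x / u) =
      ENNReal.ofReal (κ (s * Λ) x - κ (s * Λ⁻¹) x) := by
  have hΛle : Λ⁻¹ ≤ Λ := (inv_le_one_of_one_le₀ hΛ.le).trans hΛ.le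
  have hcont : ContinuousOn (fun u => w (s * u) x / u) (Icc Λ⁻¹ Λ) :=
    (hκ.continuousOn_deriv_div hΛ hs hsΛ).comp (f := fun u => (u, x)) (by fun_prop)
      fun u hu => ⟨hu, mem_univ x⟩
  have hderiv : ∀ u ∈ uIcc Λ⁻¹ Λ, HasDerivAt (fun u => κ (s * u) x) (w (s * u) x / u) u := by
    intro u hu
    rw [uIcc_of_le hΛle] at hu
    have hmem := mul_mem_Ioo hΛ hs hsΛ hu
    have h1 : HasDerivAt (fun τ => κ τ x) (w (s * u) x / (s * u)) (s * u) :=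
      (hκ.hasDerivWithinAt _ (Ioo_subset_Ioc_self hmem) x).hasDerivAt
        (Filter.mem_of_superset (isOpen_Ioo.mem_nhds hmem) Ioo_subset_Ioc_self)
    refine (h1.comp u ((hasDerivAt_id u).const_mul s)).congr_deriv ?_
    field_simp
  have h2 := intervalIntegral.integral_eq_sub_of_hasDerivAt hderiv
    (hcont.intervalIntegrable_of_Icc hΛle)
  rw [← h2, intervalIntegral.integral_of_le hΛle, ← integral_Icc_eq_integral_Ioc,
    ofReal_integral_eq_lintegral_ofReal (hcont.integrableOn_Icc)]
  refine (ae_restrict_iff' measurableSet_Icc).2 (ae_of_all _ fun u hu => ?_)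
  exact div_nonneg (hκ.deriv_nonneg _ (Ioo_subset_Ioc_self (mul_mem_Ioo hΛ hs hsΛ hu)) x)
    (lt_of_lt_of_le (by positivity : 0 < Λ⁻¹) hu.1).le

variable [MeasurableSpace X] [BorelSpace X]

theorem measurable_limitDensity (hκ : IsMonotoneDensity t₀ κ w) :
    Measurable (limitDensity t₀ κ) := by
  have hseq : Tendsto (fun k : ℕ => t₀ / (k + 1 : ℝ)) atTop (𝓝[>] 0) :=
    tendsto_nhdsWithin_iff.2 ⟨by
      simpa [div_eq_mul_inv] using (tendsto_one_div_add_atTop_nhds_zero_nat (𝕜 := ℝ)).const_mul t₀,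
      Eventually.of_forall fun k => div_pos hκ.pos (by positivity)⟩
  refine measurable_of_tendsto_metrizable (f := fun k : ℕ => κ (t₀ / (k + 1 : ℝ)))
    (fun k => (hκ.continuous ⟨div_pos hκ.pos (by positivity), ?_⟩).measurable)
    (tendsto_pi_nhds.2 fun x => (hκ.tendsto_limitDensity x).comp hseq)
  exact div_le_self hκ.pos.le (by linarith [(k.cast_nonneg : (0 : ℝ) ≤ k)])

theorem aestronglyMeasurable_prod {F : ℝ × X → ℝ} {ν : Measure X} [SFinite ν]
    (hF : ContinuousOn F (Icc Λ⁻¹ Λ ×ˢ univ)) :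
    AEStronglyMeasurable F ((volume.restrict (Icc Λ⁻¹ Λ)).prod ν) := by
  have h1 : (volume.restrict (Icc Λ⁻¹ Λ)).prod ν =
      ((volume : Measure ℝ).prod ν).restrict (Icc Λ⁻¹ Λ ×ˢ univ) := by
    rw [← Measure.prod_restrict, Measure.restrict_univ]
  rw [h1]
  exact hF.aestronglyMeasurable (measurableSet_Icc.prod MeasurableSet.univ)

variable [CompactSpace X] {m : Measure X} [IsFiniteMeasure m]

theorem lintegral_ne_top (hκ : IsMonotoneDensity t₀ κ w) (ht : t ∈ Ioc 0 t₀) :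
    ∫⁻ x, ENNReal.ofReal (κ t x) ∂m ≠ ⊤ :=
  ((hκ.continuous ht).integrable_of_hasCompactSupport
    (HasCompactSupport.of_compactSpace _)).lintegral_lt_top.ne

theorem tendsto_lintegral (hκ : IsMonotoneDensity t₀ κ w) (A : Set X) :
    Tendsto (fun t => ∫⁻ x in A, ENNReal.ofReal (κ t x) ∂m) (𝓝[>] 0)
      (𝓝 (∫⁻ x in A, ENNReal.ofReal (limitDensity t₀ κ x) ∂m)) := by
  have ht₀ : t₀ ∈ Ioc 0 t₀ := ⟨hκ.pos, le_rfl⟩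
  refine tendsto_lintegral_filter_of_dominated_convergence (fun x => ENNReal.ofReal (κ t₀ x))
    ?_ ?_ (ne_top_of_le_ne_top (hκ.lintegral_ne_top (m := m) ht₀) (setLIntegral_le_lintegral _ _))
    (ae_of_all _ fun x => ENNReal.tendsto_ofReal (hκ.tendsto_limitDensity x))
  · filter_upwards [Ioc_mem_nhdsGT hκ.pos] with t ht
    exact (hκ.continuous ht).measurable.ennreal_ofReal
  · filter_upwards [Ioc_mem_nhdsGT hκ.pos] with t ht
    exact ae_of_all _ fun x => ENNReal.ofReal_le_ofReal (hκ.monotoneOn x ht ht₀ ht.2)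

/-- Both `κ (sΛ)` and `κ (s/Λ)` converge to the limit density, dominated by `κ t₀`. -/
theorem tendsto_lintegral_sub (hκ : IsMonotoneDensity t₀ κ w) (hΛ : 1 < Λ) :
    Tendsto (fun s => ∫⁻ x, ENNReal.ofReal (κ (s * Λ) x - κ (s * Λ⁻¹) x) ∂m) (𝓝[>] 0) (𝓝 0) := by
  have ht₀ : t₀ ∈ Ioc 0 t₀ := ⟨hκ.pos, le_rfl⟩
  have hscale : ∀ c : ℝ, 0 < c → Tendsto (fun s : ℝ => s * c) (𝓝[>] 0) (𝓝[>] 0) := fun c hc => by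
    refine tendsto_nhdsWithin_iff.2 ⟨?_, ?_⟩
    · have : Tendsto (fun s : ℝ => s * c) (𝓝 0) (𝓝 (0 * c)) := tendsto_id.mul_const c
      rw [zero_mul] at this
      exact this.mono_left nhdsWithin_le_nhds
    · filter_upwards [self_mem_nhdsWithin] with s hs using mul_pos hs hc
  have h1 := hscale Λ (by linarith)
  have h2 := hscale Λ⁻¹ (by positivity)
  have hlim : Tendsto (fun s => ∫⁻ x, ENNReal.ofReal (κ (s * Λ) x - κ (s * Λ⁻¹) x) ∂m) (𝓝[>] 0)
      (𝓝 (∫⁻ _, 0 ∂m)) := by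
    refine tendsto_lintegral_filter_of_dominated_convergence (fun x => ENNReal.ofReal (κ t₀ x))
      ?_ ?_ (hκ.lintegral_ne_top ht₀) (ae_of_all _ fun x => ?_)
    · filter_upwards [h1 (Ioc_mem_nhdsGT hκ.pos), h2 (Ioc_mem_nhdsGT hκ.pos)] with s a b
      exact ((hκ.continuous a).sub (hκ.continuous b)).measurable.ennreal_ofReal
    · filter_upwards [h1 (Ioc_mem_nhdsGT hκ.pos), h2 (Ioc_mem_nhdsGT hκ.pos)] with s a b
      refine ae_of_all _ fun x => ENNReal.ofReal_le_ofReal ?_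
      linarith [hκ.monotoneOn x a ht₀ a.2, hκ.nonneg _ b x]
    · have h3 := ((hκ.tendsto_limitDensity x).comp h1).sub ((hκ.tendsto_limitDensity x).comp h2)
      rw [sub_self] at h3
      simpa using ENNReal.tendsto_ofReal h3
  simpa using hlim

theorem lintegral_lintegral_deriv (hκ : IsMonotoneDensity t₀ κ w) (hΛ : 1 < Λ) (hs : 0 < s)
    (hsΛ : s * Λ < t₀) :
    ∫⁻ u in Icc Λ⁻¹ Λ, ∫⁻ x, ENNReal.ofReal (w (s * u) x / u) ∂m =
      ∫⁻ x, ENNReal.ofReal (κ (s * Λ) x - κ (s * Λ⁻¹) x) ∂m := by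
  rw [lintegral_lintegral_swap (aestronglyMeasurable_prod
    (hκ.continuousOn_deriv_div hΛ hs hsΛ)).aemeasurable.ennreal_ofReal]
  exact lintegral_congr fun x => hκ.lintegral_time hΛ hs hsΛ x

/-- Functions whose integral at each rescaled time `u`, against the density `κ (su)`, is controlled
by the growth rate of `κ`, tend to zero in `L¹` with respect to the limit density: their norm is at
most `C ∫ (κ (sΛ) - κ (s/Λ))`, a difference of two convergent quantities. -/
theorem tendstoZeroInL1 (hκ : IsMonotoneDensity t₀ κ w) (hΛ : 1 < Λ) {G : ℝ → ℝ → X → ℝ} {C : ℝ}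
    (hG : ∀ s, 0 < s → s * Λ < t₀ →
      ContinuousOn (fun p : ℝ × X => G s p.1 p.2) (Icc Λ⁻¹ Λ ×ˢ univ))
    (hle : ∀ s, 0 < s → s * Λ < t₀ → ∀ u ∈ Icc Λ⁻¹ Λ,
      ∫⁻ x, ENNReal.ofReal (κ (s * u) x) * ENNReal.ofReal |G s u x| ∂m ≤
        ENNReal.ofReal C * ∫⁻ x, ENNReal.ofReal (w (s * u) x / u) ∂m) :
    TendstoZeroInL1 ((volume.restrict (Icc Λ⁻¹ Λ)).prod
      (m.withDensity fun x => ENNReal.ofReal (limitDensity t₀ κ x)))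
      (fun s p => |G s p.1 p.2|) := by
  set ν := m.withDensity fun x => ENNReal.ofReal (limitDensity t₀ κ x) with hν
  have hΛ0 : 0 < Λ := by linarith
  have hsmall : ∀ᶠ s in 𝓝[>] (0 : ℝ), 0 < s ∧ s * Λ < t₀ := by
    filter_upwards [Ioo_mem_nhdsGT (div_pos hκ.pos hΛ0)] with s hs
    exact ⟨hs.1, (lt_div_iff₀ hΛ0).1 hs.2⟩
  have hbound : ∀ᶠ s in 𝓝[>] (0 : ℝ),
      eLpNorm (fun p : ℝ × X => |G s p.1 p.2|) 1 ((volume.restrict (Icc Λ⁻¹ Λ)).prod ν) ≤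
        ENNReal.ofReal C * ∫⁻ x, ENNReal.ofReal (κ (s * Λ) x - κ (s * Λ⁻¹) x) ∂m := by
    filter_upwards [hsmall] with s ⟨hs, hsΛ⟩
    have h0 : ∀ p : ℝ × X, ‖|G s p.1 p.2|‖ₑ = ENNReal.ofReal |G s p.1 p.2| := fun p => by
      rw [Real.enorm_eq_ofReal (abs_nonneg _)]
    rw [eLpNorm_one_eq_lintegral_enorm, ← hκ.lintegral_lintegral_deriv hΛ hs hsΛ,
      ← lintegral_const_mul' _ _ ENNReal.ofReal_ne_top]
    simp only [h0]
    refine (lintegral_prod_le _).trans (setLIntegral_mono' measurableSet_Icc fun u hu => ?_)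
    refine le_trans ?_ (hle s hs hsΛ u hu)
    refine (lintegral_withDensity_le_lintegral_mul m
      hκ.measurable_limitDensity.ennreal_ofReal _).trans (lintegral_mono fun x => ?_)
    exact mul_le_mul_left (ENNReal.ofReal_le_ofReal (hκ.limitDensity_le
      (Ioo_subset_Ioc_self (mul_mem_Ioo hΛ hs hsΛ hu)) x)) _
  have hlim : Tendsto (fun s => ENNReal.ofReal C *
      ∫⁻ x, ENNReal.ofReal (κ (s * Λ) x - κ (s * Λ⁻¹) x) ∂m) (𝓝[>] 0) (𝓝 0) := by
    have h1 := ENNReal.Tendsto.const_mul (hκ.tendsto_lintegral_sub (m := m) hΛ)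
      (Or.inr (ENNReal.ofReal_ne_top (r := C)))
    rwa [mul_zero] at h1
  refine ⟨?_, tendsto_of_tendsto_of_tendsto_of_le_of_le' tendsto_const_nhds hlim
    (Eventually.of_forall fun _ => bot_le) hbound⟩
  filter_upwards [hsmall, hbound, hlim.eventually_lt_const ENNReal.zero_lt_top]
    with s ⟨hs, hsΛ⟩ hb hfin
  exact ⟨aestronglyMeasurable_prod (hG s hs hsΛ).abs, hb.trans_lt hfin⟩

end IsMonotoneDensity

end MonotoneDensity

/-! ### Asymptotics of the normalized volume, the lapse and the curvature -/

section Asymptotics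

open Set Filter

variable {n : ℕ} {X : Type*} [TopologicalSpace X] [ChartedSpace (EuclideanSpace ℝ (Fin n)) X]
  [IsManifold (𝓡 n) ∞ X] {L : ℝ → X → ℝ} {h : ℝ → Metric n X} {K : ℝ → TwoTensor n X}
  {t₀ t Λ : ℝ}

/-- The density of `t⁻¹ dvol_{h(t)}` with respect to `dvol_{h(t₀)}`. -/
def normalizedDensity (h : ℝ → Metric n X) (t₀ t : ℝ) (x : X) : ℝ := volRatio h t₀ t x / t

/-- The derivative `(n L - 1) t⁻¹ dvol_{h(t)}` of the normalized volume with respect to `log t`, as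
a density with respect to `dvol_{h(t₀)}`. -/
def growthRate (L : ℝ → X → ℝ) (h : ℝ → Metric n X) (t₀ t : ℝ) (x : X) : ℝ :=
  (n * L t x - 1) * normalizedDensity h t₀ t x

theorem normalizedDensity_nonneg (h : ℝ → Metric n X) (t₀ : ℝ) (ht : 0 < t) (x : X) :
    0 ≤ normalizedDensity h t₀ t x :=
  div_nonneg (volRatio_pos h t₀ t x).le ht.le

variable [CompactSpace X]

/-- The normalized volume is nondecreasing because `n L ≥ 1`. -/
theorem IsHubbleCMCFlow.isMonotoneDensity (hn : 1 ≤ n) (ht₀ : 0 < t₀)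
    (hflow : IsHubbleCMCFlow (Ioc 0 t₀) L h K)
    (hR : ∀ t ∈ Ioc 0 t₀, ∀ x, scalarCurvature (h t).inner x ≤ 0) :
    IsMonotoneDensity t₀ (normalizedDensity h t₀) (growthRate L h t₀) := by
  have hn' : (0 : ℝ) < n := by positivity
  have hmem : t₀ ∈ Ioc 0 t₀ := ⟨ht₀, le_rfl⟩
  have hκc : ContinuousOn (fun p : ℝ × X => normalizedDensity h t₀ p.1 p.2)
      (Ioc 0 t₀ ×ˢ univ) :=
    (hflow.continuousOn_volRatio hmem).div continuousOn_fst fun p hp => hp.1.1.ne'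
  refine ⟨ht₀, fun t ht x => normalizedDensity_nonneg h t₀ ht.1 x, fun t ht x => ?_,
    fun t ht x => ?_, hκc, ?_⟩
  · have h1 := (div_le_iff₀' hn').1 (hflow.lapse_ge hn ht (hR t ht) x)
    exact mul_nonneg (by linarith) (normalizedDensity_nonneg h t₀ ht.1 x)
  · have ht0 : t ≠ 0 := ht.1.ne'
    refine ((hflow.hasDerivWithinAt_volRatio ht x).div (hasDerivWithinAt_id t _) ht0).congr_deriv ?_
    simp only [growthRate, normalizedDensity, id]
    field_simp
  · exact ((continuousOn_const.mul hflow.continuousOn_lapse).sub continuousOn_const).mul hκc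

theorem IsHubbleCMCFlow.lintegral_lapse_le [MeasurableSpace X] (hn : 1 ≤ n)
    (hflow : IsHubbleCMCFlow (Ioc 0 t₀) L h K)
    (hR : ∀ t ∈ Ioc 0 t₀, ∀ x, scalarCurvature (h t).inner x ≤ 0) (hΛ : 1 < Λ) {s u : ℝ}
    (hu : u ∈ Icc Λ⁻¹ Λ) (ht : s * u ∈ Ioc 0 t₀) (m : Measure X) :
    ∫⁻ x, ENNReal.ofReal (normalizedDensity h t₀ (s * u) x) *
        ENNReal.ofReal |L (s * u) x - 1 / n| ∂m ≤
      ENNReal.ofReal Λ * ∫⁻ x, ENNReal.ofReal (growthRate L h t₀ (s * u) x / u) ∂m := by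
  have hn1 : (1 : ℝ) ≤ n := by exact_mod_cast hn
  have hn' : (0 : ℝ) < n := by positivity
  have hΛ0 : 0 < Λ := by linarith
  have hu0 : 0 < u := lt_of_lt_of_le (by positivity) hu.1
  rw [← lintegral_const_mul' _ _ ENNReal.ofReal_ne_top]
  refine lintegral_mono fun x => ?_
  have h1 := hflow.lapse_ge hn ht (hR _ ht) x
  have h3 := normalizedDensity_nonneg h t₀ ht.1 x
  rw [← ENNReal.ofReal_mul h3, ← ENNReal.ofReal_mul hΛ0.le, abs_of_nonneg (by linarith)]
  refine ENNReal.ofReal_le_ofReal ?_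
  rw [growthRate]
  generalize normalizedDensity h t₀ (s * u) x = κ at *
  generalize L (s * u) x = ℓ at *
  have h4 : 0 ≤ ℓ - 1 / n := by linarith
  have h5 : (n : ℝ) * ℓ - 1 = n * (ℓ - 1 / n) := by field_simp
  rw [h5]
  generalize ℓ - 1 / (n : ℝ) = a at *
  have h6 : 1 ≤ Λ / u * n := by
    have : 1 ≤ Λ / u := (one_le_div hu0).2 hu.2
    nlinarith
  calc κ * a ≤ Λ / u * n * (κ * a) := le_mul_of_one_le_left (mul_nonneg h3 h4) h6
    _ = Λ * (n * a * κ / u) := by ring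

variable [T2Space X] [MeasurableSpace X] [BorelSpace X]

/-- The integrated lapse equation at time `t`, with all integrals taken against the fixed measure
`dvol_{h(t₀)}`. -/
theorem IsHubbleCMCFlow.integral_mul_normalizedDensity (hn : 1 ≤ n)
    (hflow : IsHubbleCMCFlow (Ioc 0 t₀) L h K) (ht : t ∈ Ioc 0 t₀) :
    ∫ x, (L t x * normSq (h t).inner (K t) x - n / t ^ 2) * normalizedDensity h t₀ t x
      ∂(dvol (h t₀).inner) = 0 := by
  have hmem : t₀ ∈ Ioc 0 t₀ := ⟨ht.1.trans_le ht.2, le_rfl⟩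
  have hc : Continuous (volRatio h t₀ t) := continuous_slice (hflow.continuousOn_volRatio hmem) ht
  have h1 := hflow.integral_lapse_equation hn ht
  rw [hflow.dvol_eq_withDensity_volRatio hmem ht,
    integral_withDensity_eq_integral_toReal_smul hc.measurable.ennreal_ofReal
      (ae_of_all _ fun _ => ENNReal.ofReal_lt_top)] at h1
  have h2 : ∀ x, (L t x * normSq (h t).inner (K t) x - n / t ^ 2) * normalizedDensity h t₀ t x =
      t⁻¹ * ((ENNReal.ofReal (volRatio h t₀ t x)).toReal •
        (L t x * normSq (h t).inner (K t) x - n / t ^ 2)) := fun x => by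
    rw [ENNReal.toReal_ofReal (volRatio_pos h t₀ t x).le, normalizedDensity, smul_eq_mul]
    ring
  simp only [h2, integral_const_mul, h1, mul_zero]

/-- At a fixed time `t = su`, the integrated lapse equation bounds the total scalar curvature by the
growth of the normalized volume. -/
theorem IsHubbleCMCFlow.lintegral_scalarCurvature_le (hn : 1 ≤ n)
    (hflow : IsHubbleCMCFlow (Ioc 0 t₀) L h K)
    (hR : ∀ t ∈ Ioc 0 t₀, ∀ x, scalarCurvature (h t).inner x ≤ 0) (hΛ : 1 < Λ) {s u : ℝ}
    (hs : 0 < s) (hu : Λ⁻¹ ≤ u) (ht : s * u ∈ Ioc 0 t₀) :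
    ∫⁻ x, ENNReal.ofReal (normalizedDensity h t₀ (s * u) x) *
        ENNReal.ofReal |s ^ 2 * scalarCurvature (h (s * u)).inner x| ∂(dvol (h t₀).inner) ≤
      ENNReal.ofReal (n ^ 2 * Λ) *
        ∫⁻ x, ENNReal.ofReal (growthRate L h t₀ (s * u) x / u) ∂(dvol (h t₀).inner) := by
  have hn' : (0 : ℝ) < n := by positivity
  have hΛ0 : 0 < Λ := by linarith
  have hu0 : 0 < u := lt_of_lt_of_le (by positivity) hu
  have hmem : t₀ ∈ Ioc 0 t₀ := ⟨ht.1.trans_le ht.2, le_rfl⟩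
  have hκ := hflow.isMonotoneDensity hn hmem.1 hR
  have := isFiniteMeasure_dvol (hflow.c1Components hmem).continuousComponents
  set t := s * u with htdef
  set m := dvol (h t₀).inner
  have hLc : Continuous (L t) := continuous_slice hflow.continuousOn_lapse ht
  have hNc : Continuous fun x => normSq (h t).inner (K t) x :=
    continuous_slice (F := fun t x => normSq (h t).inner (K t) x) hflow.continuousOn_normSq ht
  have hκc : Continuous (normalizedDensity h t₀ t) := hκ.continuous ht
  have hwc : Continuous (growthRate L h t₀ t) := continuous_slice hκ.continuousOn_deriv ht
  have hRc : Continuous fun x => scalarCurvature (h t).inner x := by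
    simp only [hflow.scalarCurvature_eq hn ht]
    exact hNc.sub continuous_const
  have hint : ∀ {f : X → ℝ}, Continuous f → Integrable f m := fun hf =>
    hf.integrable_of_hasCompactSupport (HasCompactSupport.of_compactSpace _)
  have hi0 : Integrable (fun x => normalizedDensity h t₀ t x *
      |s ^ 2 * scalarCurvature (h t).inner x|) m :=
    hint (hκc.mul (continuous_const.mul hRc).abs)
  have hi3 : Integrable (fun x => growthRate L h t₀ t x / u) m := hint (hwc.div_const u)
  -- From `R = |K|² - n²/t²` and `n L ≥ 1`:
  -- `-R ≤ -n L R = (n²/t²) (n L - 1) - n (L |K|² - n/t²)`.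
  have hpt : ∀ x, normalizedDensity h t₀ t x * |s ^ 2 * scalarCurvature (h t).inner x| ≤
      n ^ 2 / u * (growthRate L h t₀ t x / u) - n * s ^ 2 *
        ((L t x * normSq (h t).inner (K t) x - n / t ^ 2) * normalizedDensity h t₀ t x) := by
    intro x
    have h1 : 1 ≤ n * L t x := (div_le_iff₀' hn').1 (hflow.lapse_ge hn ht (hR t ht) x)
    have h2 := hR t ht x
    have h3 := normalizedDensity_nonneg h t₀ ht.1 x
    have h4 : normSq (h t).inner (K t) x = scalarCurvature (h t).inner x + (n / t) ^ 2 := by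
      rw [hflow.scalarCurvature_eq hn ht]; ring
    have h5 : s ^ 2 / t ^ 2 = 1 / u ^ 2 := by rw [htdef]; field_simp
    rw [abs_of_nonpos (mul_nonpos_of_nonneg_of_nonpos (sq_nonneg s) h2), growthRate, h4]
    generalize normalizedDensity h t₀ t x = κ at *
    generalize scalarCurvature (h t).inner x = R at *
    generalize L t x = ℓ at *
    have e : n ^ 2 / u * ((n * ℓ - 1) * κ / u) - n * s ^ 2 *
        ((ℓ * (R + (n / t) ^ 2) - n / t ^ 2) * κ) =
        n ^ 2 * (n * ℓ - 1) * κ * (1 / u ^ 2) - n ^ 2 * (n * ℓ - 1) * κ * (s ^ 2 / t ^ 2) +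
          n * ℓ * (κ * -(s ^ 2 * R)) := by
      field_simp
      ring
    rw [e, h5, sub_self, zero_add]
    exact le_mul_of_one_le_left (mul_nonneg h3 (by nlinarith [sq_nonneg s])) h1
  have hreal : ∫ x, normalizedDensity h t₀ t x * |s ^ 2 * scalarCurvature (h t).inner x| ∂m ≤
      n ^ 2 / u * ∫ x, growthRate L h t₀ t x / u ∂m := by
    have hi1 : Integrable (fun x => (n : ℝ) ^ 2 / u * (growthRate L h t₀ t x / u)) m :=
      hint (continuous_const.mul (hwc.div_const u))
    have hi2 : Integrable (fun x => n * s ^ 2 * ((L t x * normSq (h t).inner (K t) x - n / t ^ 2) *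
        normalizedDensity h t₀ t x)) m :=
      hint (continuous_const.mul (((hLc.mul hNc).sub continuous_const).mul hκc))
    refine (integral_mono hi0 (hi1.sub hi2) hpt).trans_eq ?_
    rw [integral_sub' hi1 hi2, integral_const_mul, integral_const_mul,
      hflow.integral_mul_normalizedDensity hn ht, mul_zero, sub_zero]
  have hw0 : ∀ x, 0 ≤ growthRate L h t₀ t x / u := fun x =>
    div_nonneg (hκ.deriv_nonneg t ht x) hu0.le
  simp only [← ENNReal.ofReal_mul (normalizedDensity_nonneg h t₀ ht.1 _)]
  rw [← ofReal_integral_eq_lintegral_ofReal hi0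
      (ae_of_all _ fun x => mul_nonneg (normalizedDensity_nonneg h t₀ ht.1 x) (abs_nonneg _)),
    ← ofReal_integral_eq_lintegral_ofReal hi3 (ae_of_all _ hw0),
    ← ENNReal.ofReal_mul (by positivity)]
  refine ENNReal.ofReal_le_ofReal (hreal.trans ?_)
  refine mul_le_mul_of_nonneg_right ?_ (integral_nonneg hw0)
  rw [div_eq_mul_inv]
  exact mul_le_mul_of_nonneg_left (inv_le_of_inv_le₀ hΛ0 hu) (by positivity)

end Asymptotics

end EinsteinFlow

end

theorem theorem0p13 {n : ℕ} (hn : 1 ≤ n) {X : Type*} [TopologicalSpace X]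
    [ChartedSpace (EuclideanSpace ℝ (Fin n)) X] [IsManifold (𝓡 n) ∞ X]
    [T2Space X] [CompactSpace X] [ConnectedSpace X] [MeasurableSpace X] [BorelSpace X]
    (t₀ : ℝ) (ht₀ : 0 < t₀)
    (L : ℝ → X → ℝ) (h : ℝ → EinsteinFlow.Metric n X) (K : ℝ → EinsteinFlow.TwoTensor n X)
    (hflow : EinsteinFlow.IsHubbleCMCFlow (Set.Ioc 0 t₀) L h K)
    (hR : ∀ t ∈ Set.Ioc 0 t₀, ∀ x, EinsteinFlow.scalarCurvature (h t).inner x ≤ 0) :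
    ∃ dvol₀ : Measure X,
      (∀ A : Set X, MeasurableSet A →
        Filter.Tendsto (fun t : ℝ => ENNReal.ofReal t⁻¹ * EinsteinFlow.dvol (h t).inner A)
          (𝓝[>] 0) (𝓝 (dvol₀ A))) ∧
      ∀ Λ : ℝ, 1 < Λ →
        EinsteinFlow.TendstoZeroInL1 ((volume.restrict (Set.Icc Λ⁻¹ Λ)).prod dvol₀)
          (fun s p => |EinsteinFlow.rescaledLapse L s p.1 p.2 - 1 / n|) ∧
        EinsteinFlow.TendstoZeroInL1 ((volume.restrict (Set.Icc Λ⁻¹ Λ)).prod dvol₀)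
          (fun s p => |EinsteinFlow.normSq (EinsteinFlow.rescaledMetric h s p.1)
            (EinsteinFlow.rescaledK K s p.1) p.2 - (n : ℝ) ^ 2 / p.1 ^ 2|) ∧
        EinsteinFlow.TendstoZeroInL1 ((volume.restrict (Set.Icc Λ⁻¹ Λ)).prod dvol₀)
          (fun s p => |EinsteinFlow.scalarCurvature
            (EinsteinFlow.rescaledMetric h s p.1) p.2|) := by
  have hmem : t₀ ∈ Set.Ioc 0 t₀ := ⟨ht₀, le_rfl⟩
  have hκ := hflow.isMonotoneDensity hn ht₀ hR
  have := EinsteinFlow.isFiniteMeasure_dvol (hflow.c1Components hmem).continuousComponents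
  refine ⟨(EinsteinFlow.dvol (h t₀).inner).withDensity fun x => ENNReal.ofReal
    (EinsteinFlow.limitDensity t₀ (EinsteinFlow.normalizedDensity h t₀) x), fun A hA => ?_,
    fun Λ hΛ => ?_⟩
  · rw [withDensity_apply _ hA]
    refine (hκ.tendsto_lintegral A).congr' ?_
    filter_upwards [Ioc_mem_nhdsGT ht₀] with t ht
    rw [hflow.dvol_eq_withDensity_volRatio hmem ht, withDensity_apply _ hA,
      ← lintegral_const_mul' _ _ ENNReal.ofReal_ne_top]
    refine lintegral_congr fun x => ?_
    rw [← ENNReal.ofReal_mul (inv_nonneg.2 ht.1.le), EinsteinFlow.normalizedDensity,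
      div_eq_inv_mul]
  have hIoc : ∀ s, 0 < s → s * Λ < t₀ → ∀ u ∈ Set.Icc Λ⁻¹ Λ, s * u ∈ Set.Ioc 0 t₀ :=
    fun s hs hsΛ u hu =>
      Set.Ioo_subset_Ioc_self (EinsteinFlow.IsMonotoneDensity.mul_mem_Ioo hΛ hs hsΛ hu)
  have hu0 : ∀ u ∈ Set.Icc Λ⁻¹ Λ, 0 < u := fun u hu => lt_of_lt_of_le (by positivity) hu.1
  -- Both `R_s` and `|K_s|² - n²/u²` are equal to `s² R(su)`.
  have hcurv : ∀ G : ℝ → ℝ → X → ℝ,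
      (∀ s, 0 < s → s * Λ < t₀ → ∀ u ∈ Set.Icc Λ⁻¹ Λ, ∀ x,
        G s u x = s ^ 2 * EinsteinFlow.scalarCurvature (h (s * u)).inner x) →
      EinsteinFlow.TendstoZeroInL1 ((volume.restrict (Set.Icc Λ⁻¹ Λ)).prod
        ((EinsteinFlow.dvol (h t₀).inner).withDensity fun x => ENNReal.ofReal
          (EinsteinFlow.limitDensity t₀ (EinsteinFlow.normalizedDensity h t₀) x)))
        (fun s p => |G s p.1 p.2|) := by
    intro G hG
    refine hκ.tendstoZeroInL1 (C := n ^ 2 * Λ) hΛ (fun s hs hsΛ => ?_) fun s hs hsΛ u hu => ?_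
    · have hN := EinsteinFlow.IsMonotoneDensity.continuousOn_rescale
        (F := fun t x => EinsteinFlow.normSq (h t).inner (K t) x) hflow.continuousOn_normSq hΛ
        hs hsΛ
      have hq : ContinuousOn (fun p : ℝ × X => ((n : ℝ) / (s * p.1)) ^ 2)
          (Set.Icc Λ⁻¹ Λ ×ˢ Set.univ) :=
        (continuousOn_const.div (by fun_prop) fun p hp =>
          (hIoc s hs hsΛ p.1 hp.1).1.ne').pow 2
      refine (continuousOn_const.mul (hN.sub hq)).congr (f := fun p : ℝ × X => s ^ 2 * _)
        fun p hp => ?_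
      simp only [hG s hs hsΛ p.1 hp.1, hflow.scalarCurvature_eq hn (hIoc s hs hsΛ p.1 hp.1),
        Pi.sub_apply]
    · simp only [hG s hs hsΛ u hu]
      exact hflow.lintegral_scalarCurvature_le hn hR hΛ hs hu.1 (hIoc s hs hsΛ u hu)
  refine ⟨?_, hcurv (fun s u x => EinsteinFlow.normSq (EinsteinFlow.rescaledMetric h s u)
      (EinsteinFlow.rescaledK K s u) x - (n : ℝ) ^ 2 / u ^ 2) fun s hs hsΛ u hu x => ?_,
    hcurv (fun s u x => EinsteinFlow.scalarCurvature (EinsteinFlow.rescaledMetric h s u) x)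
      fun s hs hsΛ u hu x => EinsteinFlow.scalarCurvature_rescaledMetric h hs.ne' u x⟩
  · exact hκ.tendstoZeroInL1 (C := Λ) (G := fun s u x => L (s * u) x - 1 / n) hΛ
      (fun s hs hsΛ => (EinsteinFlow.IsMonotoneDensity.continuousOn_rescale
        hflow.continuousOn_lapse hΛ hs hsΛ).sub continuousOn_const)
      fun s hs hsΛ u hu => hflow.lintegral_lapse_le hn hR hΛ hu (hIoc s hs hsΛ u hu) _
  · rw [EinsteinFlow.normSq_rescaled h K hs.ne',
      hflow.scalarCurvature_eq hn (hIoc s hs hsΛ u hu)]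
    have := (hu0 u hu).ne'
    have := hs.ne'
    field_simp
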